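/- **Setting.** Let $\mathcal M=(\mathcal S,\mathcal A,\mathcal P,c,\gamma)$ be a Markov decision process with finite nonempty state and action spaces, costs $c(s,a)\in[0,1]$ and discount factor $\gamma\in(0,1)$. A policy $\pi$ assigns to each $s$ a distribution $\pi(\cdot|s)$ on $\mathcal A$; $V^\pi(s)=\mathbb E[\sum_{t\ge0}\gamma^t c(S_t,A_t)\mid S_0=s]$; for a distribution $\vartheta$ on $\mathcal S$, $f(\pi)=\sum_s\vartheta(s)V^\pi(s)$; and $\pi^*$ denotes an optimal policy ($V^{\pi^*}(s)\le V^\pi(s)$ for all $\pi,s$). **Method.** Given $k\ge1$, $n$, $\eta$ and $\tau$, stochastic policy mirror descent (SPMD) starts from the uniform policy $\pi_0$. At iteration $t=0,\dots,k-1$ it samples one trajectory $\xi_t=(Z_0,\dots,Z_{n-1})$ of state-action pairs by following $\pi_t$, from an arbitrary initial pair (which may be random and may depend on the earlier trajectories). With $T(z)=\min\{j\le n-1: Z_j=z\}$, put $\hat Q_t(s,a)=\sum_{j=T(s,a)}^{n-1}\gamma^{\,j-T(s,a)}c(Z_j)$ if $(s,a)$ is visited and $\hat Q_t(s,a)=0$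 otherwise. The truncated on-policy Monte Carlo (TOMC) estimate is $Q_t(s,a)=\hat Q_t(s,a)$ if $\pi_t(a|s)\ge\tau$, and $Q_t(s,a)=\frac1{1-\gamma}$ if $\pi_t(a|s)<\tau$. Then, for every $s$, $$\pi_{t+1}(\cdot|s)=\operatorname*{argmin}_{x\in\Delta_{\mathcal A}}\ \eta\langle Q_t(s,\cdot),x\rangle+D(x,\pi_t(\cdot|s)),$$ $$D(x,y)=-\sum_a x_a^{1/2}+\tfrac12\sum_a y_a^{1/2}+\tfrac12\sum_a x_a y_a^{-1/2}$$ ($D$ is the Tsallis divergence of index $1/2$). **Assumption (with constants $C\ge1$, $\rho\in(0,1)$, $\underline\nu\in(0,1]$).** Almost surely, for each of the generated policies $\pi_0,\dots,\pi_k$ the state chain has a stationary distribution $\nu$ with $\nu(s)\ge\underline\nu$ for all $s$ and $\sum_s|\mathbb P(S_t=s\mid S_0=s_0)-\nu(s)|\le C\rho^{t+1}$ for all $t\ge 0$ and $s_0\in\mathcal S$. **Parameters.** For $k\ge1$ and $\delta\in(0,1)$ put $M=\frac1{1-\gamma}$ and $$Z=\tfrac{4\sqrt{\log(|\mathcal S|k/\delta)}}{1-\gamma},\quad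 \varepsilon=\tfrac{2}{1-\gamma}\sqrt{\tfrac{\log(|\mathcal S|k/\delta)}{k}},\quad \tau=\tfrac{(1-\gamma)^2}{(4+2Z)^2|\mathcal A|},\quad \eta=\sqrt{\tfrac{|\mathcal A|^{1/2}-1}{2|\mathcal A|M^2k}},$$ $$H=\tfrac1{1-\gamma}+\tfrac{\lceil\log_\rho(\underline\nu\tau/(2C))\rceil}{\underline\nu\tau},\qquad t_{\rm mix}=\Big\lceil\log_\rho\tfrac{2\underline\nu(1-\gamma)^2}{(2+Z)^2C|\mathcal A|}\Big\rceil .$$ **Claim.** There are absolute constants $c_1,c_2>0$ such that the following holds for all $\mathcal S,\mathcal A,\gamma,C,\rho,\underline\nu$ as above and all $\delta\in(0,1)$. (1) Let $k\ge1$ and let $n\ge c_1H\log(H|\mathcal A|/\varepsilon)$ (that is, $n=\tilde\Theta(H\log(|\mathcal A|/\varepsilon))$, or larger). For every such MDP and every rule for the initial pairs, if the Assumption holds for SPMD run with the parameters above, then with probability at least $1-\delta$, simultaneously for all $\vartheta$, $$\min_{0\le t\le k-1}f(\pi_t)-f(\pi^*)\ \le\ \tfrac{4M}{1-\gamma}\sqrt{\tfrac{|\mathcal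 A|^{3/2}}{k}}+\tfrac{4\sqrt{\log(|\mathcal S|k/\delta)}}{(1-\gamma)^2\sqrt k}.$$ (2) For every accuracy $\epsilon\in(0,\frac1{1-\gamma}]$ there are $k\ge1$ and $n$ as in (1), depending only on $|\mathcal S|,|\mathcal A|,\gamma,C,\rho,\underline\nu,\delta,\epsilon$, such that for every such MDP and every rule for the initial pairs, if the Assumption holds for SPMD run with these parameters, then with probability at least $1-\delta$, simultaneously for all $\vartheta$, $\min_{0\le t\le k-1}f(\pi_t)-f(\pi^*)\le\epsilon$; and the total number of samples satisfies $$k\,n\ \le\ c_2\Big(\tfrac1{1-\gamma}+\tfrac{t_{\rm mix}(2+Z)^2|\mathcal A|}{\underline\nu(1-\gamma)^2}\Big)\Big(\tfrac{Z^2}{(1-\gamma)^2}+\tfrac{|\mathcal A|^{3/2}}{(1-\gamma)^4}\Big)\tfrac1{\epsilon^2}\,\log\Lambda ,$$ where $Z\le\frac{c_2}{1-\gamma}\sqrt{\log\Lambda}$ and $\Lambda=2+|\mathcal S|+|\mathcal A|+\frac1{1-\gamma}+\frac1{1-\rho}+C+\frac1{\underline\nu}+\frac1\delta+\frac1\epsilon$.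 -/

import Mathlib

noncomputable section

namespace TsallisSPMD

/-- A finite discounted Markov decision process with costs in `[0, 1]`:
`P s a s'` is the probability of moving to `s'` when action `a` is taken in state `s`. -/
structure MDP (S A : Type*) [Fintype S] where
  P : S → A → S → ℝ
  P_mem : ∀ s a, P s a ∈ stdSimplex ℝ S
  c : S → A → ℝ
  c_nonneg : ∀ s a, 0 ≤ c s a
  c_le_one : ∀ s a, c s a ≤ 1
  γ : ℝ
  γ_pos : 0 < γ
  γ_lt_one : γ < 1

section Basic

variable {S A : Type*} [Fintype S] [Fintype A]

/-- A randomized stationary policy: `π s a` is the probability of action `a` in state `s`. -/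
def IsPolicy (π : S → A → ℝ) : Prop := ∀ s, π s ∈ stdSimplex ℝ A

/-- The uniform policy, with which the method is initialized. -/
def uniformPolicy : S → A → ℝ := fun _ _ => 1 / (Fintype.card A : ℝ)

/-- Transition matrix of the state chain generated by the policy `π`. -/
def stateKernel (M : MDP S A) (π : S → A → ℝ) : Matrix S S ℝ :=
  Matrix.of fun s s' => ∑ a, π s a * M.P s a s'

/-- Value function: the expected discounted cost
`∑ₜ γᵗ 𝔼[c(Sₜ, Aₜ) | S₀ = s]`, where `ℙ(Sₜ = s' | S₀ = s)` is an entry of a matrix power. -/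
def value [DecidableEq S] (M : MDP S A) (π : S → A → ℝ) (s : S) : ℝ :=
  ∑' t : ℕ, M.γ ^ t * ∑ s', (stateKernel M π ^ t) s s' * ∑ a, π s' a * M.c s' a

/-- The objective `f(π) = 𝔼_{s ∼ ϑ} V^π(s)`. -/
def objective [DecidableEq S] (M : MDP S A) (ϑ : S → ℝ) (π : S → A → ℝ) : ℝ :=
  ∑ s, ϑ s * value M π s

/-- An optimal policy minimizes the value function at every state. -/
def IsOptimalPolicy [DecidableEq S] (M : MDP S A) (π : S → A → ℝ) : Prop :=
  IsPolicy π ∧ ∀ π' : S → A → ℝ, IsPolicy π' → ∀ s, value M π s ≤ value M π' s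

/-- The state chain of `π` has a stationary distribution `ν`, bounded below by `νmin`, and mixes
geometrically: `∑ₛ |ℙ(Sₜ = s | S₀ = s₀) - ν(s)| ≤ C ρ^(t+1)` for all `t` and `s₀`. -/
def MixesWith [DecidableEq S] (M : MDP S A) (π : S → A → ℝ) (C ρ νmin : ℝ) : Prop :=
  ∃ ν ∈ stdSimplex ℝ S,
    (∀ s, ∑ s', ν s' * stateKernel M π s' s = ν s) ∧
    (∀ (t : ℕ) (s₀ : S), ∑ s, |(stateKernel M π ^ t) s₀ s - ν s| ≤ C * ρ ^ (t + 1)) ∧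
    ∀ s, νmin ≤ ν s

/-- Tsallis divergence with index `p ∈ (0, 1)` between distributions `x` and `y` on actions: the
Bregman divergence of `w(x) = ∑ₐ -xₐ^p`. -/
def tsallisDiv (p : ℝ) (x y : A → ℝ) : ℝ :=
  (∑ a, -(x a ^ p)) + (1 - p) * (∑ a, y a ^ p) + p * ∑ a, x a * y a ^ (p - 1)

/-- One mirror descent step at every state, with the Tsallis divergence of index `1/2`: the
(unique) minimizer over the simplex of `x ↦ η ⟨Q(s, ·), x⟩ + D(x, π(· | s))`. -/
def mirrorStep (η : ℝ) (Q π : S → A → ℝ) : S → A → ℝ := fun s =>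
  Classical.epsilon fun x : A → ℝ => x ∈ stdSimplex ℝ A ∧
    IsMinOn (fun y : A → ℝ => η * (∑ a, Q s a * y a) + tsallisDiv (1 / 2) y (π s))
      (stdSimplex ℝ A) x

/-- First time that a trajectory of length `n` visits `z`, and `n` if it does not visit `z`. -/
def hitTime {n : ℕ} (ξ : Fin n → S × A) (z : S × A) : ℕ :=
  sInf ({t : ℕ | ∃ h : t < n, ξ ⟨t, h⟩ = z} ∪ {n})

/-- On-policy Monte Carlo estimate of the Q-function from a single trajectory: the discounted cost
collected from the first visit on (zero if there is no visit). -/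
def omc (M : MDP S A) {n : ℕ} (ξ : Fin n → S × A) (s : S) (a : A) : ℝ :=
  ∑ t : Fin n, if hitTime ξ (s, a) ≤ (t : ℕ)
    then M.γ ^ ((t : ℕ) - hitTime ξ (s, a)) * M.c (ξ t).1 (ξ t).2 else 0

/-- Truncated on-policy Monte Carlo estimate of the Q-function of `π` with threshold `τ`. -/
def tomc (M : MDP S A) (τ : ℝ) (π : S → A → ℝ) {n : ℕ} (ξ : Fin n → S × A) (s : S) (a : A) : ℝ :=
  if τ ≤ π s a then omc M ξ s a else 1 / (1 - M.γ)

/-- The policies `π₀, π₁, …, π_k` generated by stochastic policy mirror descent with constant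
stepsize `η`, truncation threshold `τ`, and the trajectory `ξ t` sampled at iteration `t`.
The policy `π_t` depends only on `ξ i` with `i < t`. -/
def spmd (M : MDP S A) (η τ : ℝ) {k n : ℕ} (ξ : Fin k → Fin n → S × A) : ℕ → S → A → ℝ
  | 0 => uniformPolicy
  | t + 1 => if h : t < k
      then mirrorStep η (tomc M τ (spmd M η τ ξ t) (ξ ⟨t, h⟩)) (spmd M η τ ξ t)
      else spmd M η τ ξ t

/-- Probability of the trajectory `ξ` when its first state-action pair is drawn from `μ₀` and the
policy `π` is followed afterwards. -/
def trajProb (M : MDP S A) (π : S → A → ℝ) (μ₀ : S × A → ℝ) {n : ℕ} (ξ : Fin n → S × A) : ℝ :=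
  ∏ j : Fin n, if (j : ℕ) = 0 then μ₀ (ξ j)
    else
      let z := ξ ⟨(j : ℕ) - 1, lt_of_le_of_lt (Nat.sub_le _ _) j.isLt⟩
      M.P z.1 z.2 (ξ j).1 * π (ξ j).1 (ξ j).2

/-- A rule for starting trajectories: the law of the first state-action pair at iteration `t`, as an
arbitrary function of the trajectories of the iterations before `t`. -/
abbrev StartRule (S A : Type*) (n : ℕ) : Type _ :=
  (t : ℕ) → (Fin t → Fin n → S × A) → S × A → ℝ

/-- The values of a starting rule are probability distributions. -/
def StartRule.IsValid {n : ℕ} (start : StartRule S A n) : Prop :=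
  ∀ t h, start t h ∈ stdSimplex ℝ (S × A)

/-- Probability of the outcome `ξ` of a run of `k` iterations, with one on-policy trajectory of
length `n` in each iteration. -/
def runWeight (M : MDP S A) (η τ : ℝ) {k n : ℕ} (start : StartRule S A n)
    (ξ : Fin k → Fin n → S × A) : ℝ :=
  ∏ t : Fin k, trajProb M (spmd M η τ ξ t)
    (start t fun i => ξ ⟨i, lt_trans i.isLt t.isLt⟩) (ξ t)

/-- Probability of an event under a run of `k` iterations. -/
def runProb (M : MDP S A) (η τ : ℝ) {k n : ℕ} (start : StartRule S A n)
    (E : Set (Fin k → Fin n → S × A)) : ℝ :=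
  ∑ ξ, E.indicator (runWeight M η τ start) ξ

/-- With probability one, the chains of all the generated policies `π₀, …, π_k` mix with the common
constants `C`, `ρ` and `νmin`. -/
def RunMixes [DecidableEq S] (M : MDP S A) (η τ : ℝ) (k : ℕ) {n : ℕ} (start : StartRule S A n)
    (C ρ νmin : ℝ) : Prop :=
  ∀ ξ : Fin k → Fin n → S × A, 0 < runWeight M η τ start ξ →
    ∀ i ≤ k, MixesWith M (spmd M η τ ξ i) C ρ νmin

/-- The optimality gap `min_{0 ≤ t ≤ k-1} f(π_t) - f(π*)` of the best iterate. -/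
def bestGap [DecidableEq S] (M : MDP S A) (η τ : ℝ) {k n : ℕ} (ϑ : S → ℝ) (πs : S → A → ℝ)
    (ξ : Fin k → Fin n → S × A) : ℝ :=
  (⨅ t : Fin k, objective M ϑ (spmd M η τ ξ t)) - objective M ϑ πs

end Basic

/-! Parameters of the method; `cS` and `cA` are the numbers of states and actions. -/

/-- `Z = 4 √(log(|S| k / δ)) / (1 - γ)`. -/
def paramZ (cS k : ℕ) (γ δ : ℝ) : ℝ := 4 * √(Real.log (cS * k / δ)) / (1 - γ)

/-- `ε = (2 / (1 - γ)) √(log(|S| k / δ) / k)`. -/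
def paramEps (cS k : ℕ) (γ δ : ℝ) : ℝ := 2 / (1 - γ) * √(Real.log (cS * k / δ) / k)

/-- `τ = (1 - γ)² / ((4 + 2 Z)² |A|)`. -/
def paramTau (cS cA k : ℕ) (γ δ : ℝ) : ℝ :=
  (1 - γ) ^ 2 / (4 + 2 * paramZ cS k γ δ) ^ 2 * (cA : ℝ)⁻¹

/-- `η = √((|A|^(1/2) - 1) / (2 |A| M² k))` with `M = 1 / (1 - γ)`. -/
def paramEta (cA k : ℕ) (γ : ℝ) : ℝ :=
  √(((cA : ℝ) ^ (1 / 2 : ℝ) - 1) / (2 * cA * (1 / (1 - γ)) ^ 2 * k))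

/-- `H = 1 / (1 - γ) + ⌈log_ρ(νmin τ / (2 C))⌉ / (νmin τ)`. -/
def paramH (cS cA k : ℕ) (γ δ C ρ νmin : ℝ) : ℝ :=
  1 / (1 - γ) + (⌈Real.logb ρ (νmin * paramTau cS cA k γ δ / (2 * C))⌉ : ℝ) /
    (νmin * paramTau cS cA k γ δ)

/-- `t_mix = ⌈log_ρ(2 νmin (1 - γ)² / ((2 + Z)² C |A|))⌉`. -/
def paramTmix (cS cA k : ℕ) (γ δ C ρ νmin : ℝ) : ℝ :=
  (⌈Real.logb ρ (2 * νmin * (1 - γ) ^ 2 / ((2 + paramZ cS k γ δ) ^ 2 * C * cA))⌉ : ℝ)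

/-- The logarithm of the problem parameters hidden in the sample complexity. -/
def logFactor (cS cA : ℕ) (γ δ C ρ νmin ϵ : ℝ) : ℝ :=
  Real.log (2 + cS + cA + 1 / (1 - γ) + 1 / (1 - ρ) + C + 1 / νmin + 1 / δ + 1 / ϵ)

end TsallisSPMD

end

set_option linter.unusedSectionVars false

noncomputable section

namespace TsallisSPMD

/-! ### Bellman equations and a deterministic optimal action map. -/

section Basics

variable {S A : Type*} [Fintype S] [Fintype A]

/-! Fix an action `α q` at each state `q` with V*(q) = Q*(q, α q). The Tsallis mirror step obeys a
regret inequality whose potential is the divergence from the vertex at `α q` to the current policy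
(`mirrorStep_regret`). The proof adds up this inequality at each state.

No exploration is forced, so estimates at improbable actions may be useless. Truncation replaces
them by 1/(1-γ), which is never below the true Q. As long as `α q` itself keeps probability at least
`τ`, these overestimates enter the regret only with the nonnegative weight of the policy, and the
upper bound on the advantage survives (`advantage_le_of_bias`). At actions of probability at least
`τ`, the Monte Carlo mean lies below Q, by at most `ε / 2` when `n` is large: mixing makes every
block of steps hit such a pair with probability at least `νmin * τ / 2`
(`qValue_sub_meanOmc_le_of_mixesWith`, `qValue_sub_meanOmc_le_eps`). The remaining centered error is
a bounded martingale difference, controlled at all states and all times by Azuma's inequality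
(`azuma_union`, `le_runProb_noise`).

On that event the probability of `α q` never falls below `τ`, by induction on time
(`sum_value_sub_le`). The summed value gaps satisfy a discounted recursion along the transitions
under `α`, and the maximum principle bounds both these gaps and the divergence from the vertex. By
`inv_sqrt_le_of_tsallisDiv`, a bounded divergence bounds the probability of the vertex from below;
`τ` is chosen so that this lower bound is at least `τ`, which closes the induction. The bound on the
summed gaps then bounds the best iterate.

For the sample complexity, `k` is the least number of iterations that brings both error terms below
half the accuracy (`exists_iterations`). All parameters are then polynomial in `Λ`, so every
logarithm is O(log `Λ`). -/

theorem MDP.one_sub_γ_pos (M : MDP S A) : 0 < 1 - M.γ := sub_pos.2 M.γ_lt_one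

theorem MDP.horizon_pos (M : MDP S A) : 0 < 1 / (1 - M.γ) := one_div_pos.2 M.one_sub_γ_pos

theorem MDP.horizon_eq (M : MDP S A) : 1 + M.γ * (1 / (1 - M.γ)) = 1 / (1 - M.γ) := by
  have := M.one_sub_γ_pos.ne'
  field_simp
  ring

theorem IsPolicy.nonneg {π : S → A → ℝ} (h : IsPolicy π) (s : S) (a : A) : 0 ≤ π s a := (h s).1 a

theorem IsPolicy.sum_eq {π : S → A → ℝ} (h : IsPolicy π) (s : S) : ∑ a, π s a = 1 := (h s).2

theorem uniformPolicy_isPolicy [Nonempty A] : IsPolicy (uniformPolicy : S → A → ℝ) := by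
  intro s
  refine ⟨fun a => by unfold uniformPolicy; positivity, ?_⟩
  simp [uniformPolicy]

theorem stateKernel_nonneg (M : MDP S A) {π : S → A → ℝ} (h : IsPolicy π) (s s' : S) :
    0 ≤ stateKernel M π s s' :=
  Finset.sum_nonneg fun a _ => mul_nonneg (h.nonneg s a) ((M.P_mem s a).1 s')

theorem sum_stateKernel_mul (M : MDP S A) (π : S → A → ℝ) (v : S → ℝ) (s : S) :
    ∑ s', stateKernel M π s s' * v s' = ∑ a, π s a * ∑ s', M.P s a s' * v s' := by
  simp only [stateKernel, Matrix.of_apply, Finset.sum_mul, Finset.mul_sum]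
  rw [Finset.sum_comm]
  simp only [mul_assoc]

theorem stateKernel_row_sum (M : MDP S A) {π : S → A → ℝ} (h : IsPolicy π) (s : S) :
    ∑ s', stateKernel M π s s' = 1 := by
  have := sum_stateKernel_mul M π (fun _ => 1) s
  simpa [(M.P_mem s _).2, h.sum_eq] using this

theorem sum_le_of_mem_stdSimplex {ι : Type*} [Fintype ι] {p : ι → ℝ} (hp : p ∈ stdSimplex ℝ ι)
    {f : ι → ℝ} {B : ℝ} (hf : ∀ i, f i ≤ B) : ∑ i, p i * f i ≤ B :=
  calc ∑ i, p i * f i ≤ ∑ i, p i * B :=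
        Finset.sum_le_sum fun i _ => mul_le_mul_of_nonneg_left (hf i) (hp.1 i)
    _ = B := by rw [← Finset.sum_mul, hp.2, one_mul]

theorem le_sum_of_mem_stdSimplex {ι : Type*} [Fintype ι] {p : ι → ℝ} (hp : p ∈ stdSimplex ℝ ι)
    {f : ι → ℝ} {B : ℝ} (hf : ∀ i, B ≤ f i) : B ≤ ∑ i, p i * f i :=
  calc B = ∑ i, p i * B := by rw [← Finset.sum_mul, hp.2, one_mul]
    _ ≤ _ := Finset.sum_le_sum fun i _ => mul_le_mul_of_nonneg_left (hf i) (hp.1 i)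

/-- Maximum principle for discounted averaging. -/
theorem nonpos_of_le_discounted [Nonempty S] {γ : ℝ} (h0 : 0 ≤ γ) (h1 : γ < 1) {p : S → S → ℝ}
    (hp : ∀ s, p s ∈ stdSimplex ℝ S) {w : S → ℝ} (hw : ∀ s, w s ≤ γ * ∑ s', p s s' * w s')
    (s : S) : w s ≤ 0 := by
  obtain ⟨s₀, hs₀⟩ := Finite.exists_max w
  have h3 := (hw s₀).trans (mul_le_mul_of_nonneg_left (sum_le_of_mem_stdSimplex (hp s₀) hs₀) h0)
  have h4 : w s₀ ≤ 0 := by nlinarith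
  exact (hs₀ s).trans h4

section Value
variable [DecidableEq S]

theorem stateKernel_pow_mem (M : MDP S A) {π : S → A → ℝ} (h : IsPolicy π) (t : ℕ) (s : S) :
    (stateKernel M π ^ t) s ∈ stdSimplex ℝ S := by
  have h1 : stateKernel M π ∈ Matrix.rowStochastic ℝ S :=
    Matrix.mem_rowStochastic_iff_sum.2 ⟨stateKernel_nonneg M h, stateKernel_row_sum M h⟩
  have h2 := Matrix.mem_rowStochastic_iff_sum.1 (Submonoid.pow_mem _ h1 t)
  exact ⟨h2.1 s, h2.2 s⟩

/-- The state-action value function. -/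
def qValue (M : MDP S A) (π : S → A → ℝ) (s : S) (a : A) : ℝ :=
  M.c s a + M.γ * ∑ s', M.P s a s' * value M π s'

theorem value_summable (M : MDP S A) {π : S → A → ℝ} (h : IsPolicy π) (s : S) :
    Summable fun t : ℕ => M.γ ^ t * ∑ s', (stateKernel M π ^ t) s s' *
      ∑ a, π s' a * M.c s' a := by
  refine Summable.of_nonneg_of_le (fun t => ?_) (fun t => ?_)
    (summable_geometric_of_lt_one M.γ_pos.le M.γ_lt_one)
  · exact mul_nonneg (pow_nonneg M.γ_pos.le _) (le_sum_of_mem_stdSimplex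
      (stateKernel_pow_mem M h t s) fun s' => le_sum_of_mem_stdSimplex (h s') (M.c_nonneg s'))
  · exact mul_le_of_le_one_right (pow_nonneg M.γ_pos.le _) (sum_le_of_mem_stdSimplex
      (stateKernel_pow_mem M h t s) fun s' => sum_le_of_mem_stdSimplex (h s') (M.c_le_one s'))

theorem value_eq (M : MDP S A) {π : S → A → ℝ} (h : IsPolicy π) (s : S) :
    value M π s = ∑ a, π s a * M.c s a +
      M.γ * ∑ s', stateKernel M π s s' * value M π s' := by
  unfold value
  rw [(value_summable M h s).tsum_eq_zero_add]
  congr 1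
  · simp [Matrix.one_apply]
  · simp_rw [← tsum_mul_left]
    have hs : ∀ i ∈ (Finset.univ : Finset S), Summable fun t : ℕ => stateKernel M π s i *
        (M.γ ^ t * ∑ s', (stateKernel M π ^ t) i s' * ∑ a, π s' a * M.c s' a) :=
      fun i _ => (value_summable M h i).mul_left _
    rw [← Summable.tsum_finsetSum hs, ← tsum_mul_left]
    refine tsum_congr fun t => ?_
    have hv := congrFun (Matrix.mulVec_mulVec (fun s' => ∑ a, π s' a * M.c s' a)
      (stateKernel M π) (stateKernel M π ^ t)) s
    rw [← pow_succ'] at hv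
    simp only [Matrix.mulVec, dotProduct] at hv
    rw [← hv, pow_succ', mul_assoc, Finset.mul_sum]
    congr 1
    exact Finset.sum_congr rfl fun i _ => mul_left_comm _ _ _

theorem value_eq_sum_qValue (M : MDP S A) {π : S → A → ℝ} (h : IsPolicy π) (s : S) :
    value M π s = ∑ a, π s a * qValue M π s a := by
  rw [value_eq M h, sum_stateKernel_mul]
  simp only [qValue, mul_add, Finset.sum_add_distrib, Finset.mul_sum]
  congr 1
  refine Finset.sum_congr rfl fun a _ => Finset.sum_congr rfl fun s' _ => ?_
  ring

theorem value_nonneg (M : MDP S A) {π : S → A → ℝ} (h : IsPolicy π) (s : S) :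
    0 ≤ value M π s :=
  tsum_nonneg fun t => mul_nonneg (pow_nonneg M.γ_pos.le _) (le_sum_of_mem_stdSimplex
      (stateKernel_pow_mem M h t s) fun s' => le_sum_of_mem_stdSimplex (h s') (M.c_nonneg s'))

theorem value_le_horizon (M : MDP S A) {π : S → A → ℝ} (h : IsPolicy π) (s : S) :
    value M π s ≤ 1 / (1 - M.γ) := by
  rw [one_div, ← tsum_geometric_of_lt_one M.γ_pos.le M.γ_lt_one]
  exact (value_summable M h s).tsum_le_tsum (fun t => mul_le_of_le_one_right
    (pow_nonneg M.γ_pos.le _) (sum_le_of_mem_stdSimplex (stateKernel_pow_mem M h t s)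
      fun s' => sum_le_of_mem_stdSimplex (h s') (M.c_le_one s')))
    (summable_geometric_of_lt_one M.γ_pos.le M.γ_lt_one)

theorem qValue_nonneg (M : MDP S A) {π : S → A → ℝ} (h : IsPolicy π) (s : S) (a : A) :
    0 ≤ qValue M π s a :=
  add_nonneg (M.c_nonneg s a) (mul_nonneg M.γ_pos.le
    (le_sum_of_mem_stdSimplex (M.P_mem s a) (value_nonneg M h)))

theorem qValue_le_horizon (M : MDP S A) {π : S → A → ℝ} (h : IsPolicy π) (s : S) (a : A) :
    qValue M π s a ≤ 1 / (1 - M.γ) := by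
  rw [← M.horizon_eq]
  exact add_le_add (M.c_le_one s a) (mul_le_mul_of_nonneg_left
    (sum_le_of_mem_stdSimplex (M.P_mem s a) (value_le_horizon M h)) M.γ_pos.le)

/-- An optimal policy can be replaced by a deterministic one: the optimal value function dominates
no action-value and is attained at the actions `α`. -/
theorem IsOptimalPolicy.exists_det [Nonempty S] [Nonempty A] {M : MDP S A} {πs : S → A → ℝ}
    (h : IsOptimalPolicy M πs) : ∃ α : S → A, ∀ s, value M πs s = qValue M πs s (α s) := by
  classical
  choose α hα using fun s => Finite.exists_min (qValue M πs s)
  refine ⟨α, ?_⟩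
  set πd : S → A → ℝ := fun s => Pi.single (α s) 1 with hπd
  have hd : IsPolicy πd := fun s => single_mem_stdSimplex ℝ (α s)
  have hge : ∀ s, qValue M πs s (α s) ≤ value M πs s := fun s => by
    rw [value_eq_sum_qValue M h.1 s]
    exact le_sum_of_mem_stdSimplex (h.1 s) (hα s)
  have hVd : ∀ s, value M πd s = qValue M πd s (α s) := fun s => by
    rw [value_eq_sum_qValue M hd s, Finset.sum_eq_single (α s)] <;> simp +contextual [hπd]
  -- Policy improvement: since `qValue M πs s (α s)` is at most `value M πs s`, the difference w of
  -- the values satisfies w ≤ γPw along the greedy transitions. Optimality of `πs` then forces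
  -- equality of the two value functions.
  have key : ∀ s, value M πd s - value M πs s ≤ 0 := by
    refine nonpos_of_le_discounted M.γ_pos.le M.γ_lt_one (fun s => M.P_mem s (α s))
      (w := fun s => value M πd s - value M πs s) fun s => ?_
    simp only [mul_sub, Finset.sum_sub_distrib]
    have h1 := hge s
    rw [hVd]
    simp only [qValue] at h1 ⊢
    linarith
  have heq : ∀ s, value M πd s = value M πs s := fun s =>
    le_antisymm (sub_nonpos.1 (key s)) (h.2 πd hd s)
  intro s
  rw [← heq s, hVd s]
  simp only [qValue, heq]

end Value
end Basics

/-! ### Trajectories, first-step recursions and the sign of the Monte Carlo bias. -/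

section Trajectories

variable {S A : Type*} [Fintype S] [Fintype A]

/-- Transition probabilities of the chain of state-action pairs. -/
def stepProb (M : MDP S A) (π : S → A → ℝ) (z z' : S × A) : ℝ := M.P z.1 z.2 z'.1 * π z'.1 z'.2

theorem sum_stepProb_mul (M : MDP S A) (π : S → A → ℝ) (z : S × A) (f : S × A → ℝ) :
    ∑ z', stepProb M π z z' * f z' = ∑ s, M.P z.1 z.2 s * ∑ a, π s a * f (s, a) := by
  simp only [stepProb, Fintype.sum_prod_type, Finset.mul_sum, mul_assoc]

theorem stepProb_mem (M : MDP S A) {π : S → A → ℝ} (h : IsPolicy π) (z : S × A) :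
    stepProb M π z ∈ stdSimplex ℝ (S × A) := by
  refine ⟨fun z' => mul_nonneg ((M.P_mem _ _).1 _) (h.nonneg _ _), ?_⟩
  have := sum_stepProb_mul M π z fun _ => 1
  simpa [h.sum_eq, (M.P_mem z.1 z.2).2] using this

/-- Markov property: after the first pair is removed, the rest is again a trajectory, with initial
law `stepProb M π z`. Every induction on the trajectory length rests on this, which is why initial
laws are kept arbitrary. -/
theorem trajProb_cons (M : MDP S A) (π : S → A → ℝ) (μ : S × A → ℝ) {n : ℕ} (z : S × A)
    (ξ : Fin n → S × A) :
    trajProb M π μ (Fin.cons z ξ : Fin (n + 1) → S × A) =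
      μ z * trajProb M π (stepProb M π z) ξ := by
  unfold trajProb
  rw [Fin.prod_univ_succ]
  congr 1
  refine Finset.prod_congr rfl fun j _ => ?_
  cases n with
  | zero => exact j.elim0
  | succ n =>
    refine Fin.cases ?_ (fun i => ?_) j
    · simp [stepProb]
    · have h1 : (⟨((i.succ.succ : Fin (n + 2)) : ℕ) - 1, lt_of_le_of_lt (Nat.sub_le _ _)
          i.succ.succ.isLt⟩ : Fin (n + 2)) = (⟨((i.succ : Fin (n + 1)) : ℕ) - 1,
          lt_of_le_of_lt (Nat.sub_le _ _) i.succ.isLt⟩ : Fin (n + 1)).succ := by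
        ext; simp
      simp only [h1, Fin.cons_succ]
      simp

theorem sum_trajProb_succ (M : MDP S A) (π : S → A → ℝ) (μ : S × A → ℝ) {n : ℕ}
    (F : (Fin (n + 1) → S × A) → ℝ) :
    ∑ ξ, trajProb M π μ ξ * F ξ =
      ∑ z, μ z * ∑ ξ : Fin n → S × A, trajProb M π (stepProb M π z) ξ *
        F (Fin.cons z ξ : Fin (n + 1) → S × A) := by
  rw [← (Fin.consEquiv (fun _ : Fin (n + 1) => S × A)).sum_comp, Fintype.sum_prod_type]
  refine Finset.sum_congr rfl fun z _ => ?_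
  rw [Finset.mul_sum]
  refine Finset.sum_congr rfl fun ξ _ => ?_
  rw [← mul_assoc, ← trajProb_cons]
  rfl

theorem trajProb_mem (M : MDP S A) {π : S → A → ℝ} (h : IsPolicy π) {μ : S × A → ℝ}
    (hμ : μ ∈ stdSimplex ℝ (S × A)) {n : ℕ} :
    (trajProb M π μ : (Fin n → S × A) → ℝ) ∈ stdSimplex ℝ (Fin n → S × A) := by
  constructor
  · intro ξ
    refine Finset.prod_nonneg fun j _ => ?_
    split_ifs
    · exact hμ.1 _
    · exact mul_nonneg ((M.P_mem _ _).1 _) (h.nonneg _ _)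
  · induction n generalizing μ with
    | zero => simp [trajProb]
    | succ n ih =>
      have h1 := sum_trajProb_succ M π μ (n := n) fun _ => 1
      simp only [mul_one] at h1
      rw [h1]
      simp only [ih (stepProb_mem M h _), mul_one, hμ.2]

theorem hitTime_cons_self {n : ℕ} (z : S × A) (ξ : Fin n → S × A) :
    hitTime (Fin.cons z ξ : Fin (n + 1) → S × A) z = 0 :=
  Nat.sInf_eq_zero.2 (Or.inl (Or.inl ⟨Nat.succ_pos n, rfl⟩))

theorem hitTime_cons_of_ne {n : ℕ} {z z₀ : S × A} (hz : z ≠ z₀) (ξ : Fin n → S × A) :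
    hitTime (Fin.cons z ξ : Fin (n + 1) → S × A) z₀ = hitTime ξ z₀ + 1 := by
  unfold hitTime
  -- The default value `n` of a missed visit becomes `n + 1`, so the shift by one holds whether or
  -- not the pair is visited.
  set p : ℕ → Prop := fun t => t ∈ ({t : ℕ | ∃ h : t < n + 1,
    (Fin.cons z ξ : Fin (n + 1) → S × A) ⟨t, h⟩ = z₀} ∪ {n + 1}) with hp
  have h1 : ∀ t, p (t + 1) ↔ t ∈ ({t : ℕ | ∃ h : t < n, ξ ⟨t, h⟩ = z₀} ∪ {n}) := by
    intro t
    simp only [hp, Set.mem_union, Set.mem_ofPred_eq, Set.mem_singleton_iff, add_left_inj,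
      add_lt_add_iff_right]
    exact or_congr (exists_congr fun h => Iff.rfl) Iff.rfl
  have h0 : ¬ p 0 := by
    rintro (⟨_, h⟩ | h)
    · exact hz h
    · exact absurd h (Nat.succ_ne_zero n).symm
  have hne : {m | p m}.Nonempty := ⟨n + 1, Or.inr rfl⟩
  have h2 : 1 ≤ sInf {m | p m} := by
    rw [Nat.one_le_iff_ne_zero]
    intro h
    have := Nat.sInf_mem hne
    rw [h] at this
    exact h0 this
  have h3 := Nat.sInf_add h2
  simp only [h1] at h3
  exact h3.symm

/-- Discounted cost of a trajectory. -/
def trajCost (M : MDP S A) {n : ℕ} (ξ : Fin n → S × A) : ℝ :=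
  ∑ t : Fin n, M.γ ^ (t : ℕ) * M.c (ξ t).1 (ξ t).2

theorem omc_cons_self (M : MDP S A) {n : ℕ} (s : S) (a : A) (ξ : Fin n → S × A) :
    omc M (Fin.cons (s, a) ξ : Fin (n + 1) → S × A) s a = M.c s a + M.γ * trajCost M ξ := by
  unfold omc trajCost
  rw [Fin.sum_univ_succ, hitTime_cons_self, Finset.mul_sum]
  simp [pow_succ', mul_assoc]

theorem omc_cons_of_ne (M : MDP S A) {n : ℕ} {z : S × A} {s : S} {a : A} (hz : z ≠ (s, a))
    (ξ : Fin n → S × A) :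
    omc M (Fin.cons z ξ : Fin (n + 1) → S × A) s a = omc M ξ s a := by
  unfold omc
  rw [Fin.sum_univ_succ, hitTime_cons_of_ne hz]
  simp

theorem trajCost_le_horizon (M : MDP S A) {n : ℕ} (ξ : Fin n → S × A) :
    trajCost M ξ ≤ 1 / (1 - M.γ) := by
  rw [one_div, ← tsum_geometric_of_lt_one M.γ_pos.le M.γ_lt_one]
  calc trajCost M ξ ≤ ∑ t : Fin n, M.γ ^ (t : ℕ) :=
        Finset.sum_le_sum fun t _ => mul_le_of_le_one_right (pow_nonneg M.γ_pos.le _)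
          (M.c_le_one _ _)
    _ = ∑ t ∈ Finset.range n, M.γ ^ t := Fin.sum_univ_eq_sum_range (fun t => M.γ ^ t) n
    _ ≤ _ := (summable_geometric_of_lt_one M.γ_pos.le M.γ_lt_one).sum_le_tsum _
        fun _ _ => pow_nonneg M.γ_pos.le _

theorem omc_nonneg (M : MDP S A) {n : ℕ} (ξ : Fin n → S × A) (s : S) (a : A) :
    0 ≤ omc M ξ s a := by
  refine Finset.sum_nonneg fun _ _ => ?_
  split_ifs
  · exact mul_nonneg (pow_nonneg M.γ_pos.le _) (M.c_nonneg _ _)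
  · exact le_rfl

theorem omc_le_horizon (M : MDP S A) {n : ℕ} (ξ : Fin n → S × A) (s : S) (a : A) :
    omc M ξ s a ≤ 1 / (1 - M.γ) := by
  induction n with
  | zero => simpa [omc] using M.γ_lt_one.le
  | succ n ih =>
    rw [← Fin.cons_self_tail ξ]
    by_cases hz : ξ 0 = (s, a)
    · rw [hz, omc_cons_self, ← M.horizon_eq]
      exact add_le_add (M.c_le_one _ _)
        (mul_le_mul_of_nonneg_left (trajCost_le_horizon M _) M.γ_pos.le)
    · rw [omc_cons_of_ne M hz]
      exact ih _

theorem tomc_nonneg (M : MDP S A) (τ : ℝ) (π : S → A → ℝ) {n : ℕ} (ξ : Fin n → S × A) (s : S)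
    (a : A) : 0 ≤ tomc M τ π ξ s a := by
  unfold tomc
  split_ifs
  · exact omc_nonneg M ξ s a
  · exact M.horizon_pos.le

theorem tomc_le_horizon (M : MDP S A) (τ : ℝ) (π : S → A → ℝ) {n : ℕ} (ξ : Fin n → S × A)
    (s : S) (a : A) : tomc M τ π ξ s a ≤ 1 / (1 - M.γ) := by
  unfold tomc
  split_ifs
  · exact omc_le_horizon M ξ s a
  · exact le_rfl

/-- Expectation of the discounted cost of a trajectory. -/
def meanCost (M : MDP S A) (π : S → A → ℝ) (μ : S × A → ℝ) (n : ℕ) : ℝ :=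
  ∑ ξ : Fin n → S × A, trajProb M π μ ξ * trajCost M ξ

/-- Expectation of the on-policy Monte Carlo estimate. -/
def meanOmc (M : MDP S A) (π : S → A → ℝ) (μ : S × A → ℝ) (n : ℕ) (s : S) (a : A) : ℝ :=
  ∑ ξ : Fin n → S × A, trajProb M π μ ξ * omc M ξ s a

theorem meanOmc_nonneg (M : MDP S A) {π : S → A → ℝ} (h : IsPolicy π) {μ : S × A → ℝ}
    (hμ : μ ∈ stdSimplex ℝ (S × A)) (n : ℕ) (s : S) (a : A) : 0 ≤ meanOmc M π μ n s a :=
  le_sum_of_mem_stdSimplex (trajProb_mem M h hμ) fun ξ => omc_nonneg M ξ s a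

theorem meanOmc_le_horizon (M : MDP S A) {π : S → A → ℝ} (h : IsPolicy π) {μ : S × A → ℝ}
    (hμ : μ ∈ stdSimplex ℝ (S × A)) (n : ℕ) (s : S) (a : A) :
    meanOmc M π μ n s a ≤ 1 / (1 - M.γ) :=
  sum_le_of_mem_stdSimplex (trajProb_mem M h hμ) fun ξ => omc_le_horizon M ξ s a

theorem meanCost_succ (M : MDP S A) {π : S → A → ℝ} (h : IsPolicy π) (μ : S × A → ℝ) (n : ℕ) :
    meanCost M π μ (n + 1) =
      ∑ z, μ z * (M.c z.1 z.2 + M.γ * meanCost M π (stepProb M π z) n) := by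
  unfold meanCost
  rw [sum_trajProb_succ]
  refine Finset.sum_congr rfl fun z _ => congrArg _ ?_
  have h1 : ∀ ξ : Fin n → S × A, trajCost M (Fin.cons z ξ : Fin (n + 1) → S × A) =
      M.c z.1 z.2 + M.γ * trajCost M ξ := by
    intro ξ
    unfold trajCost
    rw [Fin.sum_univ_succ, Finset.mul_sum]
    simp [pow_succ', mul_assoc]
  simp only [h1, mul_add, Finset.sum_add_distrib]
  rw [← Finset.sum_mul, (trajProb_mem M h (stepProb_mem M h z)).2, one_mul, Finset.mul_sum]
  congr 1
  refine Finset.sum_congr rfl fun ξ _ => ?_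
  ring

/-- First-step analysis: once the target pair is hit, the estimator is a plain truncated discounted
cost; before that, the sample is discarded and the estimator starts afresh. -/
theorem meanOmc_succ [DecidableEq (S × A)] (M : MDP S A) {π : S → A → ℝ} (h : IsPolicy π)
    (μ : S × A → ℝ) (n : ℕ) (s : S) (a : A) :
    meanOmc M π μ (n + 1) s a = ∑ z, μ z * if z = (s, a)
      then M.c s a + M.γ * meanCost M π (stepProb M π (s, a)) n
      else meanOmc M π (stepProb M π z) n s a := by
  unfold meanOmc meanCost
  rw [sum_trajProb_succ]
  refine Finset.sum_congr rfl fun z _ => congrArg _ ?_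
  split_ifs with hz
  · subst hz
    simp only [omc_cons_self, mul_add, Finset.sum_add_distrib]
    rw [← Finset.sum_mul, (trajProb_mem M h (stepProb_mem M h _)).2, one_mul, Finset.mul_sum]
    congr 1
    refine Finset.sum_congr rfl fun ξ _ => ?_
    ring
  · simp only [omc_cons_of_ne M hz]

section Bias
variable [DecidableEq S]

theorem qValue_eq_sum_stepProb (M : MDP S A) {π : S → A → ℝ} (h : IsPolicy π) (z : S × A) :
    qValue M π z.1 z.2 =
      M.c z.1 z.2 + M.γ * ∑ z', stepProb M π z z' * qValue M π z'.1 z'.2 := by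
  rw [sum_stepProb_mul]
  simp only [← value_eq_sum_qValue M h]
  rfl

/-- Cutting the discounted sum at length `n` only drops nonnegative costs, worth at most `γ ^ n / (1
- γ)`. -/
theorem meanCost_bounds (M : MDP S A) {π : S → A → ℝ} (h : IsPolicy π) (n : ℕ) {μ : S × A → ℝ}
    (hμ : μ ∈ stdSimplex ℝ (S × A)) :
    meanCost M π μ n ≤ ∑ z, μ z * qValue M π z.1 z.2 ∧
      ∑ z, μ z * qValue M π z.1 z.2 - M.γ ^ n * (1 / (1 - M.γ)) ≤ meanCost M π μ n := by
  induction n generalizing μ with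
  | zero =>
    have h0 : meanCost M π μ 0 = 0 := by simp [meanCost, trajCost]
    rw [h0, pow_zero, one_mul, sub_nonpos]
    exact ⟨le_sum_of_mem_stdSimplex hμ fun z => qValue_nonneg M h _ _,
      sum_le_of_mem_stdSimplex hμ fun z => qValue_le_horizon M h _ _⟩
  | succ n ih =>
    rw [meanCost_succ M h]
    constructor
    · refine Finset.sum_le_sum fun z _ => mul_le_mul_of_nonneg_left ?_ (hμ.1 z)
      rw [qValue_eq_sum_stepProb M h]
      gcongr
      · exact M.γ_pos.le
      · exact (ih (stepProb_mem M h z)).1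
    · rw [sub_le_iff_le_add, ← sub_le_iff_le_add', ← Finset.sum_sub_distrib]
      simp only [← mul_sub]
      refine sum_le_of_mem_stdSimplex hμ fun z => ?_
      rw [qValue_eq_sum_stepProb M h]
      have := mul_le_mul_of_nonneg_left (ih (stepProb_mem M h z)).2 M.γ_pos.le
      rw [pow_succ']
      linarith

/-- Both sources of bias, the finite length and the default value 0 of an unvisited pair, lower the
estimate. This sign matters: an underestimate at the optimal action does no harm in the regret. -/
theorem meanOmc_le_qValue (M : MDP S A) {π : S → A → ℝ} (h : IsPolicy π) (n : ℕ)
    {μ : S × A → ℝ} (hμ : μ ∈ stdSimplex ℝ (S × A)) (s : S) (a : A) :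
    meanOmc M π μ n s a ≤ qValue M π s a := by
  classical
  induction n generalizing μ with
  | zero => simpa [meanOmc, omc] using qValue_nonneg M h s a
  | succ n ih =>
    rw [meanOmc_succ M h]
    refine sum_le_of_mem_stdSimplex hμ fun z => ?_
    split_ifs
    · rw [qValue_eq_sum_stepProb M h (s, a)]
      gcongr
      · exact M.γ_pos.le
      · exact (meanCost_bounds M h n (stepProb_mem M h _)).1
    · exact ih (stepProb_mem M h z)

end Bias

/-! ### Probability that a finite chain misses a point. -/

section Missing
variable {X : Type*} [Fintype X] [DecidableEq X]

/-- One step of a finite Markov chain killed at `z₀`. -/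
def missOp (p : X → X → ℝ) (z₀ : X) (φ : X → ℝ) (z : X) : ℝ :=
  ∑ z', p z z' * if z' = z₀ then 0 else φ z'

/-- Probability that a finite Markov chain is at `z₀` after `t + 1` steps. -/
def reachProb (p : X → X → ℝ) (z₀ : X) : ℕ → X → ℝ
  | 0, z => p z z₀
  | t + 1, z => ∑ z', p z z' * reachProb p z₀ t z'

theorem missOp_iterate_nonneg {p : X → X → ℝ} (hp : ∀ z, p z ∈ stdSimplex ℝ X) (z₀ : X)
    {φ : X → ℝ} (h0 : ∀ z, 0 ≤ φ z) (t : ℕ) (z : X) : 0 ≤ (missOp p z₀)^[t] φ z := by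
  induction t generalizing z with
  | zero => exact h0 z
  | succ t ih =>
    rw [Function.iterate_succ_apply']
    refine le_sum_of_mem_stdSimplex (hp z) fun z' => ?_
    split_ifs
    · exact le_rfl
    · exact ih z'

/-- The iterate is the expectation of `φ` after `t + 1` steps on the event that `z₀` was avoided at
all of them; that event excludes being at `z₀` at the last step. -/
theorem missOp_iterate_le {p : X → X → ℝ} (hp : ∀ z, p z ∈ stdSimplex ℝ X) (z₀ : X)
    {φ : X → ℝ} {B : ℝ} (h0 : ∀ z, 0 ≤ φ z) (hB : ∀ z, φ z ≤ B) (t : ℕ) (z : X) :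
    (missOp p z₀)^[t + 1] φ z ≤ B * (1 - reachProb p z₀ t z) := by
  induction t generalizing z with
  | zero =>
    have h1 : B * (1 - reachProb p z₀ 0 z) = ∑ z', p z z' * if z' = z₀ then 0 else B := by
      have h2 : ∀ z', (p z z' * if z' = z₀ then 0 else B) =
          p z z' * B - if z' = z₀ then p z z' * B else 0 := by
        intro z'
        split_ifs <;> ring
      simp only [h2, Finset.sum_sub_distrib, ← Finset.sum_mul, (hp z).2]
      simp [reachProb]
      ring
    rw [h1]
    refine Finset.sum_le_sum fun z' _ => mul_le_mul_of_nonneg_left ?_ ((hp z).1 z')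
    split_ifs
    · exact le_rfl
    · exact hB z'
  | succ t ih =>
    rw [Function.iterate_succ_apply']
    have h1 : B * (1 - reachProb p z₀ (t + 1) z) =
        ∑ z', p z z' * (B * (1 - reachProb p z₀ t z')) := by
      simp only [reachProb, mul_sub, Finset.sum_sub_distrib, mul_one, ← Finset.sum_mul, (hp z).2,
        Finset.mul_sum, one_mul]
      congr 1
      exact Finset.sum_congr rfl fun z' _ => by ring
    rw [h1]
    refine Finset.sum_le_sum fun z' _ => mul_le_mul_of_nonneg_left ?_ ((hp z).1 z')
    split_ifs
    · exact (missOp_iterate_nonneg hp z₀ h0 (t + 1) z').trans (ih z')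
    · exact ih z'

/-- By the Markov property, each block of `t + 1` steps multiplies the probability of a miss by at
most `1 - β`, whatever the starting point. -/
theorem missOp_iterate_block {p : X → X → ℝ} (hp : ∀ z, p z ∈ stdSimplex ℝ X) (z₀ : X)
    {t : ℕ} {β : ℝ} (hβ1 : β ≤ 1) (hβ : ∀ z, β ≤ reachProb p z₀ t z) (j : ℕ) (z : X) :
    (missOp p z₀)^[j * (t + 1)] (fun _ => 1) z ≤ (1 - β) ^ j := by
  induction j generalizing z with
  | zero => simp
  | succ j ih =>
    rw [show (j + 1) * (t + 1) = (t + 1) + j * (t + 1) by ring, Function.iterate_add_apply]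
    refine (missOp_iterate_le hp z₀ (missOp_iterate_nonneg hp z₀ (fun _ => zero_le_one) _) ih t
      z).trans ?_
    rw [pow_succ]
    exact mul_le_mul_of_nonneg_left (sub_le_sub_left (hβ z) 1) (pow_nonneg (sub_nonneg.2 hβ1) _)

end Missing

/-! ### Bias of the estimator under mixing. -/

section Bias
variable [DecidableEq S]

/-- Mixing is assumed for the state chain only. The pair chain leaves an arbitrary `z` by the MDP
kernel, makes `t` moves of the state chain, and then draws its action: `t + 1` steps of pairs match
the power `t`. -/
theorem reachProb_stepProb [DecidableEq A] (M : MDP S A) (π : S → A → ℝ) (q : S) (a : A)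
    (t : ℕ) (z : S × A) : reachProb (stepProb M π) (q, a) t z =
      (∑ s, M.P z.1 z.2 s * (stateKernel M π ^ t) s q) * π q a := by
  induction t generalizing z with
  | zero => simp [reachProb, stepProb, Matrix.one_apply]
  | succ t ih =>
    simp only [reachProb, ih]
    rw [sum_stepProb_mul, Finset.sum_mul]
    refine Finset.sum_congr rfl fun s _ => ?_
    rw [pow_succ', Matrix.mul_apply, sum_stateKernel_mul, Finset.mul_sum, Finset.mul_sum,
      Finset.sum_mul]
    refine Finset.sum_congr rfl fun b _ => ?_
    ring

/-- Here `m` steps are reserved for waiting and `r` for collecting cost. A visit within the first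
`m` steps leaves a truncation error of at most `γ ^ r / (1 - γ)`; otherwise the error is at most the
horizon, weighted by the probability of missing the pair. -/
theorem qValue_sub_meanOmc_le [DecidableEq A] (M : MDP S A) {π : S → A → ℝ} (h : IsPolicy π)
    (s : S) (a : A) (r m : ℕ) (z : S × A) :
    qValue M π s a - meanOmc M π (stepProb M π z) (m + r) s a ≤
      1 / (1 - M.γ) * (M.γ ^ r + (missOp (stepProb M π) (s, a))^[m] (fun _ => 1) z) := by
  induction m generalizing z with
  | zero =>
    have h1 := meanOmc_nonneg M h (stepProb_mem M h z) (0 + r) s a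
    have h2 := qValue_le_horizon M h s a
    have h3 := mul_nonneg M.horizon_pos.le (pow_nonneg M.γ_pos.le r)
    simp only [Function.iterate_zero, id]
    linarith
  | succ m ih =>
    rw [show m + 1 + r = (m + r) + 1 by ring, meanOmc_succ M h, Function.iterate_succ_apply']
    have hz := stepProb_mem M h z
    have e1 : qValue M π s a = ∑ z', stepProb M π z z' * qValue M π s a := by
      rw [← Finset.sum_mul, hz.2, one_mul]
    have e2 : M.γ ^ r = ∑ z', stepProb M π z z' * M.γ ^ r := by
      rw [← Finset.sum_mul, hz.2, one_mul]
    rw [e1, e2, missOp, ← Finset.sum_sub_distrib, ← Finset.sum_add_distrib, Finset.mul_sum]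
    refine Finset.sum_le_sum fun z' _ => ?_
    rw [← mul_sub, ← mul_add, mul_left_comm]
    refine mul_le_mul_of_nonneg_left ?_ (hz.1 z')
    split_ifs
    · rw [qValue_eq_sum_stepProb M h (s, a)]
      have h1 := mul_le_mul_of_nonneg_left
        (meanCost_bounds M h (m + r) (stepProb_mem M h (s, a))).2 M.γ_pos.le
      have h2 : M.γ * M.γ ^ (m + r) ≤ M.γ ^ r := by
        rw [← pow_succ']
        exact pow_le_pow_of_le_one M.γ_pos.le M.γ_lt_one.le (by omega)
      have h3 := mul_le_mul_of_nonneg_right h2 M.horizon_pos.le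
      linarith
    · exact ih z'

/-- Bias of the on-policy Monte Carlo estimate at a pair whose probability is at least `τ`. -/
theorem qValue_sub_meanOmc_le_of_mixesWith [Nonempty S] (M : MDP S A) {π : S → A → ℝ}
    (h : IsPolicy π) {C ρ νmin τ : ℝ} (hmix : MixesWith M π C ρ νmin) (hτ : 0 ≤ τ)
    {t : ℕ} (ht : C * ρ ^ (t + 1) ≤ νmin / 2) (hν : 0 ≤ νmin) (hντ : νmin * τ ≤ 1) {s : S} {a : A}
    (ha : τ ≤ π s a) {μ : S × A → ℝ} (hμ : μ ∈ stdSimplex ℝ (S × A)) (j r : ℕ) :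
    qValue M π s a - meanOmc M π μ (j * (t + 1) + r + 1) s a ≤
      1 / (1 - M.γ) * (M.γ ^ r + (1 - νmin * τ / 2) ^ j) := by
  classical
  obtain ⟨ν, hν1, -, hν2, hν3⟩ := hmix
  have hreach : ∀ z, νmin * τ / 2 ≤ reachProb (stepProb M π) (s, a) t z := by
    intro z
    rw [reachProb_stepProb, show νmin * τ / 2 = νmin / 2 * τ by ring]
    have h1 : νmin / 2 ≤ ∑ s', M.P z.1 z.2 s' * (stateKernel M π ^ t) s' s := by
      refine le_sum_of_mem_stdSimplex (M.P_mem _ _) fun s' => ?_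
      have h2 : |(stateKernel M π ^ t) s' s - ν s| ≤ _ := (Finset.single_le_sum (f := fun i => |(stateKernel M π ^ t) s' i - ν i|)
        (fun i _ => abs_nonneg _) (Finset.mem_univ s)).trans (hν2 t s')
      have h3 := neg_abs_le ((stateKernel M π ^ t) s' s - ν s)
      have h4 := hν3 s
      linarith
    exact mul_le_mul h1 ha hτ ((by positivity : (0:ℝ) ≤ νmin / 2).trans h1)
  have hmiss := missOp_iterate_block (stepProb_mem M h) (s, a) (by linarith) hreach j
  have hb : (0:ℝ) ≤ 1 - νmin * τ / 2 := by linarith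
  -- The extra `+ 1` in the length is the arbitrary initial pair, which is not drawn from
  -- `stepProb`.
  rw [meanOmc_succ M h, sub_le_iff_le_add, ← sub_le_iff_le_add']
  refine le_sum_of_mem_stdSimplex hμ fun z => ?_
  split_ifs
  · rw [qValue_eq_sum_stepProb M h (s, a)]
    have h1 := mul_le_mul_of_nonneg_left
      (meanCost_bounds M h (j * (t + 1) + r) (stepProb_mem M h (s, a))).2 M.γ_pos.le
    have h2 : M.γ * M.γ ^ (j * (t + 1) + r) ≤ M.γ ^ r := by
      rw [← pow_succ']
      exact pow_le_pow_of_le_one M.γ_pos.le M.γ_lt_one.le (by omega)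
    have h3 := mul_le_mul_of_nonneg_right h2 M.horizon_pos.le
    have h4 := mul_nonneg M.horizon_pos.le (pow_nonneg hb j)
    linarith
  · have h1 := qValue_sub_meanOmc_le M h s a r (j * (t + 1)) z
    have h2 := mul_le_mul_of_nonneg_left (hmiss z) M.horizon_pos.le
    linarith

end Bias
end Trajectories

/-! ### The Tsallis mirror descent step. -/

section MirrorStep

variable {A : Type*} [Fintype A]

/-- For index 1/2 the Bregman divergence is a weighted sum of squares in the variables `√x` and
`√y`; nonnegativity, definiteness and the regret estimate can be read off from it. -/
theorem tsallisDiv_half_eq {x y : A → ℝ} (hx : ∀ a, 0 ≤ x a) (hy : ∀ a, 0 < y a) :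
    tsallisDiv (1 / 2) x y = ∑ a, (√(x a) - √(y a)) ^ 2 / (2 * √(y a)) := by
  unfold tsallisDiv
  rw [Finset.mul_sum, Finset.mul_sum, ← Finset.sum_add_distrib, ← Finset.sum_add_distrib]
  refine Finset.sum_congr rfl fun a _ => ?_
  have h1 : y a ^ ((1:ℝ) / 2 - 1) = (√(y a))⁻¹ := by
    rw [show (1:ℝ) / 2 - 1 = -(1 / 2) by norm_num, Real.rpow_neg (hy a).le, Real.sqrt_eq_rpow]
  rw [h1, ← Real.sqrt_eq_rpow, ← Real.sqrt_eq_rpow]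
  have h2 := Real.sqrt_pos.2 (hy a)
  have h3 := Real.sq_sqrt (hx a)
  have h4 := Real.sq_sqrt (hy a).le
  field_simp
  nlinarith

theorem tsallisDiv_half_nonneg {x y : A → ℝ} (hx : ∀ a, 0 ≤ x a) (hy : ∀ a, 0 < y a) :
    0 ≤ tsallisDiv (1 / 2) x y := by
  rw [tsallisDiv_half_eq hx hy]
  exact Finset.sum_nonneg fun a _ => by positivity

theorem eq_of_tsallisDiv_half_eq_zero {x y : A → ℝ} (hx : ∀ a, 0 ≤ x a) (hy : ∀ a, 0 < y a)
    (h : tsallisDiv (1 / 2) x y ≤ 0) : x = y := by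
  have h0 := le_antisymm h (tsallisDiv_half_nonneg hx hy)
  rw [tsallisDiv_half_eq hx hy, Finset.sum_eq_zero_iff_of_nonneg fun a _ => by positivity] at h0
  funext a
  have h1 := h0 a (Finset.mem_univ a)
  have h2 := Real.sqrt_pos.2 (hy a)
  rw [div_eq_zero_iff, or_iff_left (by positivity), sq_eq_zero_iff, sub_eq_zero] at h1
  exact (Real.sqrt_inj (hx a) (hy a).le).1 h1

/-- The normalizing multiplier of the mirror descent step. -/
theorem exists_tsallis_multiplier [Nonempty A] {y g : A → ℝ} (hy : ∀ a, 0 < y a)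
    (hy1 : ∑ a, y a = 1) (hg : ∀ a, 0 ≤ g a) :
    ∃ l : ℝ, (∀ a, 0 < (√(y a))⁻¹ + g a - l) ∧ ∑ a, (((√(y a))⁻¹ + g a - l)⁻¹) ^ 2 = 1 := by
  obtain ⟨a₀, ha₀⟩ := Finite.exists_min fun a => (√(y a))⁻¹ + g a
  set b : A → ℝ := fun a => (√(y a))⁻¹ + g a with hb
  have hy_le : ∀ a, y a ≤ 1 := fun a => hy1 ▸
    Finset.single_le_sum (fun i _ => (hy i).le) (Finset.mem_univ a)
  have hb1 : ∀ a, 1 ≤ b a := fun a => by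
    have h1 : 1 ≤ (√(y a))⁻¹ :=
      (one_le_inv₀ (Real.sqrt_pos.2 (hy a))).2 (Real.sqrt_le_one.2 (hy_le a))
    exact h1.trans (le_add_of_nonneg_right (hg a))
  have hpos : ∀ l ∈ Set.Icc 0 (b a₀ - 1), ∀ a, 0 < b a - l := fun l hl a => by
    have := ha₀ a
    linarith [hl.2]
  have hcont : ContinuousOn (fun l => ∑ a, ((b a - l)⁻¹) ^ 2) (Set.Icc 0 (b a₀ - 1)) :=
    continuousOn_finsetSum _ fun a _ => ((continuousOn_const.sub continuousOn_id).inv₀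
      fun l hl => (hpos l hl a).ne').pow 2
  have h0 : ∑ a, ((b a - 0)⁻¹) ^ 2 ≤ 1 := by
    rw [← hy1]
    refine Finset.sum_le_sum fun a _ => ?_
    have h1 := Real.sqrt_pos.2 (hy a)
    calc ((b a - 0)⁻¹) ^ 2 ≤ (((√(y a))⁻¹)⁻¹) ^ 2 := by
          rw [sub_zero]
          exact pow_le_pow_left₀ (inv_nonneg.2 (by linarith [hb1 a])) (inv_anti₀ (by positivity)
            (le_add_of_nonneg_right (hg a))) 2
      _ = y a := by rw [inv_inv, Real.sq_sqrt (hy a).le]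
  have h1 : 1 ≤ ∑ a, ((b a - (b a₀ - 1))⁻¹) ^ 2 := by
    have h2 := Finset.single_le_sum (f := fun a => ((b a - (b a₀ - 1))⁻¹) ^ 2)
      (fun a _ => sq_nonneg _) (Finset.mem_univ a₀)
    simpa using h2
  -- At `l = 0` the sum is at most `∑ y = 1` because `g ≥ 0`; at `l = b a₀ - 1` the term of `a₀`
  -- alone equals 1, and all denominators are still at least 1.
  obtain ⟨l, hl, hl1⟩ := intermediate_value_Icc (sub_nonneg.2 (hb1 a₀)) hcont ⟨h0, h1⟩
  exact ⟨l, hpos l hl, hl1⟩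

/-- The objective of the mirror descent step. -/
def stepObj (η : ℝ) (q y x : A → ℝ) : ℝ := η * (∑ a, q a * x a) + tsallisDiv (1 / 2) x y

/-- Characterization of the mirror descent step: it has full support and satisfies the three-point
identity with equality. -/
theorem exists_three_point [Nonempty A] {η : ℝ} (hη : 0 ≤ η) {q y : A → ℝ}
    (hq : ∀ a, 0 ≤ q a) (hy : ∀ a, 0 < y a) (hy1 : ∑ a, y a = 1) :
    ∃ x ∈ stdSimplex ℝ A, (∀ a, 0 < x a) ∧ ∀ z ∈ stdSimplex ℝ A,
      stepObj η q y z = stepObj η q y x + tsallisDiv (1 / 2) z x := by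
  obtain ⟨l, hl, hl1⟩ := exists_tsallis_multiplier hy hy1 (g := fun a => 2 * η * q a)
    fun a => by have := hq a; positivity
  -- This solves the Lagrange condition `1 / √x = 1 / √y + 2 η q - l`. The minimizer is interior, so
  -- the three-point inequality is an equality: the multiplier term cancels because `x` and `z` both
  -- sum to 1.
  set x : A → ℝ := fun a => (((√(y a))⁻¹ + 2 * η * q a - l)⁻¹) ^ 2 with hx
  have hx0 : ∀ a, 0 < x a := fun a => pow_pos (inv_pos.2 (hl a)) 2
  refine ⟨x, ⟨fun a => (hx0 a).le, hl1⟩, hx0, fun z hz => ?_⟩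
  have hsx : ∀ a, (√(x a))⁻¹ = (√(y a))⁻¹ + 2 * η * q a - l := fun a => by
    rw [hx, Real.sqrt_sq (inv_pos.2 (hl a)).le, inv_inv]
  have hD : ∀ u : A → ℝ, ∀ v : A → ℝ, (∀ a, 0 ≤ u a) → (∀ a, 0 < v a) →
      tsallisDiv (1 / 2) u v = ∑ a, (u a * (√(v a))⁻¹ / 2 - √(u a) + √(v a) / 2) := by
    intro u v hu hv
    rw [tsallisDiv_half_eq hu hv]
    refine Finset.sum_congr rfl fun a _ => ?_
    have h2 := Real.sqrt_pos.2 (hv a)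
    have h3 := Real.sq_sqrt (hu a)
    field_simp
    nlinarith
  unfold stepObj
  rw [hD z y hz.1 hy, hD x y (fun a => (hx0 a).le) hy, hD z x hz.1 hx0]
  have key : ∀ a, η * (q a * z a) + (z a * (√(y a))⁻¹ / 2 - √(z a) + √(y a) / 2) =
      η * (q a * x a) + (x a * (√(y a))⁻¹ / 2 - √(x a) + √(y a) / 2) +
      (z a * (√(x a))⁻¹ / 2 - √(z a) + √(x a) / 2) + l / 2 * (z a - x a) := by
    intro a
    have h1 : x a * (√(x a))⁻¹ = √(x a) := by
      have := Real.sqrt_pos.2 (hx0 a)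
      have h3 := Real.mul_self_sqrt (hx0 a).le
      field_simp
      linarith
    have h2 := hsx a
    have h3 : x a * ((√(y a))⁻¹ + 2 * η * q a - l) = √(x a) := by rw [← h2, h1]
    rw [h2]
    linarith
  have hsum : ∑ a, l / 2 * (z a - x a) = 0 := by
    rw [← Finset.mul_sum, Finset.sum_sub_distrib, hz.2]
    have : ∑ a, x a = 1 := hl1
    rw [this]
    ring
  have total := Finset.sum_congr (rfl : (Finset.univ : Finset A) = Finset.univ) fun a _ => key a
  simp only [Finset.sum_add_distrib, Finset.sum_sub_distrib, ← Finset.mul_sum] at total hsum ⊢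
  linarith

/-- The choice operator in `mirrorStep` returns some minimizer; the three-point identity leaves only
one, the explicit point with full support. -/
theorem mirrorStep_spec {S : Type*} [Nonempty A] {η : ℝ} (hη : 0 ≤ η) {Q π : S → A → ℝ} {s : S}
    (hq : ∀ a, 0 ≤ Q s a) (hy : ∀ a, 0 < π s a) (hy1 : ∑ a, π s a = 1) :
    mirrorStep η Q π s ∈ stdSimplex ℝ A ∧ (∀ a, 0 < mirrorStep η Q π s a) ∧
      ∀ z ∈ stdSimplex ℝ A, stepObj η (Q s) (π s) z =
        stepObj η (Q s) (π s) (mirrorStep η Q π s) +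
          tsallisDiv (1 / 2) z (mirrorStep η Q π s) := by
  obtain ⟨x, hx, hx0, hx1⟩ := exists_three_point hη hq hy hy1
  have hmin : x ∈ stdSimplex ℝ A ∧
      IsMinOn (stepObj η (Q s) (π s)) (stdSimplex ℝ A) x := ⟨hx, fun z hz => by
    change stepObj η (Q s) (π s) x ≤ stepObj η (Q s) (π s) z
    rw [hx1 z hz]
    exact le_add_of_nonneg_right (tsallisDiv_half_nonneg hz.1 hx0)⟩
  have hspec : mirrorStep η Q π s ∈ stdSimplex ℝ A ∧
      IsMinOn (stepObj η (Q s) (π s)) (stdSimplex ℝ A) (mirrorStep η Q π s) :=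
    Classical.epsilon_spec (p := fun x : A → ℝ => x ∈ stdSimplex ℝ A ∧
      IsMinOn (stepObj η (Q s) (π s)) (stdSimplex ℝ A) x) ⟨x, hmin⟩
  have heq : mirrorStep η Q π s = x := by
    refine eq_of_tsallisDiv_half_eq_zero hspec.1.1 hx0 ?_
    have h1 : stepObj η (Q s) (π s) (mirrorStep η Q π s) ≤ stepObj η (Q s) (π s) x :=
      hspec.2 hx
    rw [hx1 _ hspec.1] at h1
    linarith
  rw [heq]
  exact ⟨hx, hx0, hx1⟩

/-- One-step regret inequality of mirror descent. -/
theorem mirrorStep_regret {S : Type*} [Nonempty A] {η B : ℝ} (hη : 0 ≤ η) {Q π : S → A → ℝ}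
    {s : S} (hq : ∀ a, 0 ≤ Q s a) (hqB : ∀ a, Q s a ≤ B) (hy : ∀ a, 0 < π s a)
    (hy1 : ∑ a, π s a = 1) {z : A → ℝ} (hz : z ∈ stdSimplex ℝ A) :
    η * ∑ a, Q s a * (π s a - z a) ≤ tsallisDiv (1 / 2) z (π s) -
      tsallisDiv (1 / 2) z (mirrorStep η Q π s) + 2 * η ^ 2 * B ^ 2 := by
  obtain ⟨hx, hx0, hx1⟩ := mirrorStep_spec hη hq hy hy1
  set x := mirrorStep η Q π s
  have h1 := hx1 z hz
  unfold stepObj at h1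
  -- Stability term, coordinate by coordinate with `u = √π`, `v = √x`. Use `u² - v² ≤ 2u(u - v)`,
  -- valid against `Q ≥ 0`, and complete the square. The remainder `2 (ηQ)² u³` is at most `2 (ηB)²
  -- u²`, which sums to the bound with no factor `|A|`.
  have h2 : η * ∑ a, Q s a * (π s a - x a) - tsallisDiv (1 / 2) x (π s) ≤ 2 * η ^ 2 * B ^ 2 := by
    rw [tsallisDiv_half_eq hx.1 hy, Finset.mul_sum, ← Finset.sum_sub_distrib,
      ← mul_one (2 * η ^ 2 * B ^ 2), ← hy1, Finset.mul_sum]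
    refine Finset.sum_le_sum fun a _ => ?_
    have hu := Real.sqrt_pos.2 (hy a)
    have hv := Real.sqrt_nonneg (x a)
    have hu2 := Real.sq_sqrt (hy a).le
    have hv2 := Real.sq_sqrt (hx0 a).le
    have hu1 : √(π s a) ≤ 1 := Real.sqrt_le_one.2
      (hy1 ▸ Finset.single_le_sum (fun i _ => (hy i).le) (Finset.mem_univ a))
    rw [← hu2, ← hv2]
    set u := √(π s a)
    set v := √(x a)
    have hb : 0 ≤ η * Q s a := mul_nonneg hη (hq a)
    have hbB : η * Q s a ≤ η * B := mul_le_mul_of_nonneg_left (hqB a) hη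
    have e1 : √(u ^ 2) = u := Real.sqrt_sq hu.le
    have e2 : √(v ^ 2) = v := Real.sqrt_sq hv
    rw [e1, e2]
    have hbb : (η * Q s a) ^ 2 ≤ (η * B) ^ 2 := pow_le_pow_left₀ hb hbB 2
    have e3 : η * (Q s a * (u ^ 2 - v ^ 2)) ≤ 2 * (η * Q s a) * u * (u - v) := by
      have : 0 ≤ (η * Q s a) * (u - v) ^ 2 := by positivity
      nlinarith
    have e4 : 2 * (η * Q s a) * u * (u - v) - (v - u) ^ 2 / (2 * u) ≤
        2 * (η * Q s a) ^ 2 * u ^ 3 := by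
      have : 0 ≤ ((u - v) - 2 * (η * Q s a) * u ^ 2) ^ 2 / (2 * u) := by positivity
      have e5 : ((u - v) - 2 * (η * Q s a) * u ^ 2) ^ 2 / (2 * u) =
        (v - u) ^ 2 / (2 * u) - 2 * (η * Q s a) * u * (u - v) + 2 * (η * Q s a) ^ 2 * u ^ 3 := by
        field_simp
        ring
      linarith
    have e6 : u ^ 3 ≤ u ^ 2 := pow_le_pow_of_le_one hu.le hu1 (by norm_num)
    have e7 : 2 * (η * Q s a) ^ 2 * u ^ 3 ≤ 2 * η ^ 2 * B ^ 2 * u ^ 2 := by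
      have := mul_le_mul hbb e6 (by positivity) (by positivity)
      linarith
    linarith
  simp only [mul_sub, Finset.sum_sub_distrib] at h1 h2 ⊢
  linarith

/-- The divergence from a vertex controls the probability of that vertex. -/
theorem inv_sqrt_le_of_tsallisDiv [DecidableEq A] {y : A → ℝ} (hy : ∀ a, 0 < y a)
    (hy1 : ∑ a, y a = 1) (a : A) :
    (√(y a))⁻¹ ≤ 1 + 2 * tsallisDiv (1 / 2) (Pi.single a 1) y := by
  have hy_le : ∀ b, √(y b) ≤ 1 := fun b => Real.sqrt_le_one.2 (hy1 ▸
    Finset.single_le_sum (fun i _ => (hy i).le) (Finset.mem_univ b))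
  -- The divergence from the vertex equals `-1 + (∑ √y) / 2 + 1 / (2 √(y a))`, so `∑ √y ≥ 1`
  -- suffices.
  have h1 : 1 ≤ ∑ b, √(y b) := by
    rw [← hy1]
    refine Finset.sum_le_sum fun b _ => ?_
    have h2 := Real.mul_self_sqrt (hy b).le
    nlinarith [Real.sqrt_nonneg (y b), hy_le b]
  unfold tsallisDiv
  have e1 : ∑ b, -((Pi.single a 1 : A → ℝ) b ^ ((1:ℝ) / 2)) = -1 := by
    rw [Finset.sum_eq_single a]
    · simp
    · intro b _ hb
      simp [hb]
    · simp
  have e2 : ∑ b, (Pi.single a 1 : A → ℝ) b * y b ^ ((1:ℝ) / 2 - 1) = (√(y a))⁻¹ := by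
    rw [Finset.sum_eq_single a]
    · rw [show (1:ℝ) / 2 - 1 = -(1 / 2) by norm_num, Real.rpow_neg (hy a).le,
        Real.sqrt_eq_rpow]
      simp
    · intro b _ hb
      simp [hb]
    · simp
  rw [e1, e2]
  simp only [← Real.sqrt_eq_rpow]
  linarith

theorem tsallisDiv_single_uniform {S : Type*} [DecidableEq A] [Nonempty A] (s : S) (a : A) :
    tsallisDiv (1 / 2) (Pi.single a 1) ((uniformPolicy : S → A → ℝ) s) =
      √(Fintype.card A) - 1 := by
  have hA : (0:ℝ) < Fintype.card A := by exact_mod_cast Fintype.card_pos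
  have h0 := Real.sqrt_pos.2 hA
  rw [tsallisDiv_half_eq (single_mem_stdSimplex ℝ a).1
    (fun b => by unfold uniformPolicy; positivity)]
  have hu : √(1 / (Fintype.card A : ℝ)) = (√(Fintype.card A))⁻¹ := by
    rw [one_div, Real.sqrt_inv]
  simp only [uniformPolicy, hu]
  rw [← Finset.add_sum_erase _ _ (Finset.mem_univ a), Finset.sum_congr rfl
    (g := fun _ => (√(Fintype.card A))⁻¹ / 2)]
  · rw [Finset.sum_const, Finset.card_erase_of_mem (Finset.mem_univ a), Finset.card_univ,
      nsmul_eq_mul, Nat.cast_sub Fintype.card_pos]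
    have h2 := Real.sq_sqrt hA.le
    set r := √(Fintype.card A : ℝ)
    rw [← h2]
    simp
    field_simp
    ring
  · intro b hb
    have : b ≠ a := Finset.ne_of_mem_erase hb
    simp [this]
    field_simp
    exact Real.sq_sqrt hA.le

end MirrorStep

/-! ### Adapted sampling and Azuma's inequality on a finite space. -/

section SequentialSampling

variable {X : Type*} [Fintype X]

/-- Probability of a finite sequence of samples, the law of each of which depends on the previous
ones. -/
def seqWeight (w : (t : ℕ) → (Fin t → X) → X → ℝ) {k : ℕ} (ξ : Fin k → X) : ℝ :=
  ∏ t : Fin k, w t (fun i => ξ ⟨i, lt_trans i.isLt t.isLt⟩) (ξ t)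

/-- Sum along a sequence of samples of a function of the past and the current sample. -/
def seqSum (Y : (t : ℕ) → (Fin t → X) → X → ℝ) {k : ℕ} (ξ : Fin k → X) : ℝ :=
  ∑ t : Fin k, Y t (fun i => ξ ⟨i, lt_trans i.isLt t.isLt⟩) (ξ t)

theorem snoc_restrict {k : ℕ} (ξ : Fin k → X) (x : X) (t : Fin k) :
    (fun i : Fin (t.castSucc : ℕ) => (Fin.snoc ξ x : Fin (k + 1) → X)
      ⟨i, lt_trans i.isLt t.castSucc.isLt⟩) = fun i : Fin t => ξ ⟨i, lt_trans i.isLt t.isLt⟩ := by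
  funext i
  have h : (i : ℕ) < k := lt_trans i.isLt t.isLt
  exact Fin.snoc_castSucc (α := fun _ => X) x ξ ⟨i, h⟩

theorem snoc_restrict_last {k : ℕ} (ξ : Fin k → X) (x : X) :
    (fun i : Fin (Fin.last k : ℕ) => (Fin.snoc ξ x : Fin (k + 1) → X)
      ⟨i, lt_trans i.isLt (Fin.last k).isLt⟩) = ξ := by
  funext i
  exact Fin.snoc_castSucc (α := fun _ => X) x ξ i

theorem seqWeight_snoc (w : (t : ℕ) → (Fin t → X) → X → ℝ) {k : ℕ} (ξ : Fin k → X) (x : X) :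
    seqWeight w (Fin.snoc ξ x : Fin (k + 1) → X) = seqWeight w ξ * w k ξ x := by
  unfold seqWeight
  rw [Fin.prod_univ_castSucc]
  congr 1
  · refine Finset.prod_congr rfl fun t _ => ?_
    rw [snoc_restrict, Fin.snoc_castSucc (α := fun _ => X)]
    rfl
  · rw [snoc_restrict_last, Fin.snoc_last (α := fun _ => X)]
    rfl

theorem seqSum_snoc (Y : (t : ℕ) → (Fin t → X) → X → ℝ) {k : ℕ} (ξ : Fin k → X) (x : X) :
    seqSum Y (Fin.snoc ξ x : Fin (k + 1) → X) = seqSum Y ξ + Y k ξ x := by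
  unfold seqSum
  rw [Fin.sum_univ_castSucc]
  congr 1
  · refine Finset.sum_congr rfl fun t _ => ?_
    rw [snoc_restrict, Fin.snoc_castSucc (α := fun _ => X)]
    rfl
  · rw [snoc_restrict_last, Fin.snoc_last (α := fun _ => X)]
    rfl

theorem sum_seqWeight_succ (w : (t : ℕ) → (Fin t → X) → X → ℝ) {k : ℕ}
    (F : (Fin (k + 1) → X) → ℝ) :
    ∑ ξ, seqWeight w ξ * F ξ =
      ∑ ξ : Fin k → X, seqWeight w ξ * ∑ x, w k ξ x * F (Fin.snoc ξ x : Fin (k + 1) → X) := by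
  rw [← (Fin.snocEquiv (fun _ : Fin (k + 1) => X)).sum_comp, Fintype.sum_prod_type,
    Finset.sum_comm]
  refine Finset.sum_congr rfl fun ξ _ => ?_
  rw [Finset.mul_sum]
  refine Finset.sum_congr rfl fun x _ => ?_
  rw [← mul_assoc, ← seqWeight_snoc]
  rfl

theorem seqWeight_mem {w : (t : ℕ) → (Fin t → X) → X → ℝ}
    (hw : ∀ t h, w t h ∈ stdSimplex ℝ X) {k : ℕ} :
    (seqWeight w : (Fin k → X) → ℝ) ∈ stdSimplex ℝ (Fin k → X) := by
  refine ⟨fun ξ => Finset.prod_nonneg fun t _ => (hw _ _).1 _, ?_⟩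
  induction k with
  | zero => simp [seqWeight]
  | succ k ih =>
    have h1 := sum_seqWeight_succ w (k := k) fun _ => 1
    simp only [mul_one, (hw _ _).2] at h1
    rw [h1, ih]

theorem sum_seqWeight_exp_le {w : (t : ℕ) → (Fin t → X) → X → ℝ}
    (hw : ∀ t h, w t h ∈ stdSimplex ℝ X) {Y : (t : ℕ) → (Fin t → X) → X → ℝ} {B : ℝ}
    (hB0 : 0 ≤ B) (hB : ∀ t h, ∑ x, w t h x * Real.exp (Y t h x) ≤ B) (k : ℕ) :
    ∑ ξ : Fin k → X, seqWeight w ξ * Real.exp (seqSum Y ξ) ≤ B ^ k := by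
  induction k with
  | zero => simp [seqWeight, seqSum]
  | succ k ih =>
    rw [sum_seqWeight_succ]
    calc _ = ∑ ξ : Fin k → X, (seqWeight w ξ * Real.exp (seqSum Y ξ)) *
          ∑ x, w k ξ x * Real.exp (Y k ξ x) := by
          refine Finset.sum_congr rfl fun ξ _ => ?_
          rw [mul_assoc, Finset.mul_sum (a := Real.exp _)]
          congr 1
          refine Finset.sum_congr rfl fun x _ => ?_
          rw [seqSum_snoc, Real.exp_add]
          ring
      _ ≤ ∑ ξ : Fin k → X, (seqWeight w ξ * Real.exp (seqSum Y ξ)) * B :=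
          Finset.sum_le_sum fun ξ _ => mul_le_mul_of_nonneg_left (hB k ξ)
            (mul_nonneg ((seqWeight_mem hw).1 ξ) (Real.exp_pos _).le)
      _ ≤ B ^ k * B := by
          rw [← Finset.sum_mul]
          exact mul_le_mul_of_nonneg_right ih hB0
      _ = B ^ (k + 1) := (pow_succ _ _).symm

/-- Hoeffding's lemma for a finite distribution. -/
theorem sum_mul_exp_le_of_abs_le {p Y : X → ℝ} (hp : p ∈ stdSimplex ℝ X) {R : ℝ} (hR : 0 < R)
    (hY : ∀ x, |Y x| ≤ R) (h0 : ∑ x, p x * Y x = 0) (l : ℝ) :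
    ∑ x, p x * Real.exp (l * Y x) ≤ Real.exp ((l * R) ^ 2 / 2) := by
  -- The exponential lies below its chord over `[-lR, lR]`; averaging a centered `Y` leaves `cosh
  -- (lR)`.
  have h1 : ∀ x, Real.exp (l * Y x) ≤
      Real.cosh (l * R) + Y x * (Real.sinh (l * R) / R) := by
    intro x
    obtain ⟨ha, hb⟩ := abs_le.1 (hY x)
    have hc := convexOn_exp.2 (Set.mem_univ (l * R)) (Set.mem_univ (-(l * R)))
      (div_nonneg (by linarith) (by linarith) : 0 ≤ (R + Y x) / (2 * R))
      (div_nonneg (by linarith) (by linarith) : 0 ≤ (R - Y x) / (2 * R))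
      (by field_simp; ring)
    simp only [smul_eq_mul] at hc
    have e1 : (R + Y x) / (2 * R) * (l * R) + (R - Y x) / (2 * R) * (-(l * R)) = l * Y x := by
      field_simp
      ring
    rw [e1] at hc
    refine hc.trans (le_of_eq ?_)
    rw [Real.cosh_eq, Real.sinh_eq]
    field_simp
    ring
  calc ∑ x, p x * Real.exp (l * Y x)
      ≤ ∑ x, p x * (Real.cosh (l * R) + Y x * (Real.sinh (l * R) / R)) :=
        Finset.sum_le_sum fun x _ => mul_le_mul_of_nonneg_left (h1 x) (hp.1 x)
    _ = Real.cosh (l * R) := by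
        simp only [mul_add, Finset.sum_add_distrib, ← mul_assoc, ← Finset.sum_mul, h0, hp.2]
        ring
    _ ≤ _ := Real.cosh_le_exp_half_sq _

/-- Azuma's inequality with a union bound over finitely many martingale difference sequences. -/
theorem azuma_union {ι : Type*} [Fintype ι] {w : (t : ℕ) → (Fin t → X) → X → ℝ}
    (hw : ∀ t h, w t h ∈ stdSimplex ℝ X) {Y : ι → (t : ℕ) → (Fin t → X) → X → ℝ} {R : ℝ}
    (hR : 0 < R) (hY : ∀ i t h x, |Y i t h x| ≤ R) (h0 : ∀ i t h, ∑ x, w t h x * Y i t h x = 0)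
    {k : ℕ} (hk : 1 ≤ k) {u : ℝ} (hu : 0 ≤ u) :
    1 - Fintype.card ι * Real.exp (-(u ^ 2 / (2 * k * R ^ 2))) ≤
      ∑ ξ : Fin k → X, {ξ : Fin k → X | ∀ i, seqSum (Y i) ξ ≤ u}.indicator (seqWeight w) ξ := by
  classical
  have hk0 : (0:ℝ) < k := by exact_mod_cast hk
  -- The minimizer over `l` of the Chernoff exponent `k (lR)² / 2 - lu`.
  set l : ℝ := u / (k * R ^ 2) with hl
  have hl0 : 0 ≤ l := by positivity
  have htail : ∀ i, ∑ ξ : Fin k → X, seqWeight w ξ * Real.exp (l * seqSum (Y i) ξ - l * u) ≤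
      Real.exp (-(u ^ 2 / (2 * k * R ^ 2))) := by
    intro i
    have h1 := sum_seqWeight_exp_le hw (Y := fun t h x => l * Y i t h x) (Real.exp_pos _).le
      (fun t h => sum_mul_exp_le_of_abs_le (hw t h) hR (hY i t h) (h0 i t h) l) k
    have h2 : ∀ ξ : Fin k → X, seqSum (fun t h x => l * Y i t h x) ξ = l * seqSum (Y i) ξ :=
      fun ξ => (Finset.mul_sum _ _ _).symm
    simp only [h2] at h1
    simp only [Real.exp_sub, ← mul_div_assoc, ← Finset.sum_div]
    rw [div_le_iff₀ (Real.exp_pos _), ← Real.exp_add]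
    refine h1.trans (le_of_eq ?_)
    rw [← Real.exp_nat_mul, hl]
    congr 1
    field_simp
    ring
  have hpt : ∀ ξ : Fin k → X, seqWeight w ξ ≤
      {ξ : Fin k → X | ∀ i, seqSum (Y i) ξ ≤ u}.indicator (seqWeight w) ξ +
        ∑ i, seqWeight w ξ * Real.exp (l * seqSum (Y i) ξ - l * u) := by
    intro ξ
    have hwξ := (seqWeight_mem hw).1 ξ
    by_cases hξ : ∀ i, seqSum (Y i) ξ ≤ u
    · rw [Set.indicator_of_mem (by exact hξ)]
      exact le_add_of_nonneg_right (Finset.sum_nonneg fun i _ =>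
        mul_nonneg hwξ (Real.exp_pos _).le)
    · rw [Set.indicator_of_notMem (by exact hξ), zero_add]
      push Not at hξ
      obtain ⟨i, hi⟩ := hξ
      refine le_trans ?_ (Finset.single_le_sum (f := fun i => seqWeight w ξ *
        Real.exp (l * seqSum (Y i) ξ - l * u))
        (fun i _ => mul_nonneg hwξ (Real.exp_pos _).le) (Finset.mem_univ i))
      refine le_mul_of_one_le_right hwξ (Real.one_le_exp ?_)
      rw [← mul_sub]
      exact mul_nonneg hl0 (by linarith)
  have hsum := Finset.sum_le_sum fun (ξ : Fin k → X) (_ : ξ ∈ Finset.univ) => hpt ξ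
  rw [(seqWeight_mem hw).2, Finset.sum_add_distrib, Finset.sum_comm] at hsum
  have h3 := Finset.sum_le_sum fun (i : ι) (_ : i ∈ Finset.univ) => htail i
  rw [Finset.sum_const, nsmul_eq_mul, Finset.card_univ] at h3
  linarith

end SequentialSampling

/-! ### Runs of the algorithm as adapted sampling. -/

section Runs

variable {S A : Type*} [Fintype S] [Fintype A]

theorem spmd_succ (M : MDP S A) (η τ : ℝ) {k n : ℕ} (ξ : Fin k → Fin n → S × A) {t : ℕ}
    (h : t < k) : spmd M η τ ξ (t + 1) =
      mirrorStep η (tomc M τ (spmd M η τ ξ t) (ξ ⟨t, h⟩)) (spmd M η τ ξ t) := by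
  rw [spmd, dif_pos h]

/-- Adaptedness: the policy at time `j` is a function of the trajectories before `j`. This exhibits
a run as a sequence of samples with conditional laws `iterLaw`. -/
theorem spmd_restrict (M : MDP S A) (η τ : ℝ) {k n : ℕ} (ξ : Fin k → Fin n → S × A) {t : ℕ}
    (ht : t ≤ k) {j : ℕ} (hj : j ≤ t) :
    spmd M η τ (fun i : Fin t => ξ ⟨i, i.isLt.trans_le ht⟩) j = spmd M η τ ξ j := by
  induction j with
  | zero => rfl
  | succ j ih => rw [spmd_succ _ _ _ _ hj, spmd_succ _ _ _ _ (lt_of_lt_of_le hj ht), ih (by omega)]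

theorem spmd_pos_and_isPolicy [Nonempty A] (M : MDP S A) {η : ℝ} (hη : 0 ≤ η) (τ : ℝ) {k n : ℕ}
    (ξ : Fin k → Fin n → S × A) (t : ℕ) :
    (∀ s a, 0 < spmd M η τ ξ t s a) ∧ IsPolicy (spmd M η τ ξ t) := by
  induction t with
  | zero =>
    exact ⟨fun s a => by simp only [spmd, uniformPolicy]; positivity, uniformPolicy_isPolicy⟩
  | succ t ih =>
    by_cases h : t < k
    · rw [spmd_succ M η τ ξ h]
      have h1 := fun s => mirrorStep_spec (s := s) hη (tomc_nonneg M τ (spmd M η τ ξ t) (ξ ⟨t, h⟩) s)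
        (ih.1 s) (ih.2.sum_eq s)
      exact ⟨fun s => (h1 s).2.1, fun s => (h1 s).1⟩
    · rw [spmd, dif_neg h]
      exact ih

theorem spmd_isPolicy [Nonempty A] (M : MDP S A) {η : ℝ} (hη : 0 ≤ η) (τ : ℝ) {k n : ℕ}
    (ξ : Fin k → Fin n → S × A) (t : ℕ) : IsPolicy (spmd M η τ ξ t) :=
  (spmd_pos_and_isPolicy M hη τ ξ t).2

theorem spmd_pos [Nonempty A] (M : MDP S A) {η : ℝ} (hη : 0 ≤ η) (τ : ℝ) {k n : ℕ}
    (ξ : Fin k → Fin n → S × A) (t : ℕ) (s : S) (a : A) : 0 < spmd M η τ ξ t s a :=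
  (spmd_pos_and_isPolicy M hη τ ξ t).1 s a

/-- Law of the trajectory of an iteration given those of the previous iterations. -/
def iterLaw (M : MDP S A) (η τ : ℝ) {n : ℕ} (start : StartRule S A n) (t : ℕ)
    (h : Fin t → Fin n → S × A) : (Fin n → S × A) → ℝ :=
  trajProb M (spmd M η τ h t) (start t h)

theorem iterLaw_mem [Nonempty A] (M : MDP S A) {η : ℝ} (hη : 0 ≤ η) (τ : ℝ) {n : ℕ}
    {start : StartRule S A n} (hs : start.IsValid) (t : ℕ) (h : Fin t → Fin n → S × A) :
    iterLaw M η τ start t h ∈ stdSimplex ℝ (Fin n → S × A) :=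
  trajProb_mem M (spmd_isPolicy M hη τ h t) (hs t h)

theorem runWeight_eq_seqWeight (M : MDP S A) (η τ : ℝ) {k n : ℕ} (start : StartRule S A n) :
    (runWeight M η τ start : (Fin k → Fin n → S × A) → ℝ) =
      seqWeight (iterLaw M η τ start) := by
  funext ξ
  refine Finset.prod_congr rfl fun t _ => ?_
  rw [iterLaw, spmd_restrict M η τ ξ t.isLt.le le_rfl]

/-- Centered estimation error, at the state `q`, of the trajectory of an iteration, in the
direction from the action `α` to the current policy. -/
def noise [DecidableEq A] (M : MDP S A) (τ : ℝ) (π : S → A → ℝ) (μ : S × A → ℝ) {n : ℕ}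
    (α : A) (q : S) (x : Fin n → S × A) : ℝ :=
  ∑ a, if τ ≤ π q a
    then (meanOmc M π μ n q a - omc M x q a) * (π q a - (Pi.single α 1 : A → ℝ) a) else 0

theorem abs_noise_le [DecidableEq A] (M : MDP S A) (τ : ℝ) {π : S → A → ℝ} (hπ : IsPolicy π)
    {μ : S × A → ℝ} (hμ : μ ∈ stdSimplex ℝ (S × A)) {n : ℕ} (α : A) (q : S)
    (x : Fin n → S × A) : |noise M τ π μ α q x| ≤ 2 * (1 / (1 - M.γ)) := by
  calc |noise M τ π μ α q x|
      -- Estimate and mean both lie in `[0, 1 / (1 - γ)]`, and the direction has total variation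
      -- norm at most 2.
      ≤ ∑ a, 1 / (1 - M.γ) * (π q a + (Pi.single α 1 : A → ℝ) a) := by
        refine (Finset.abs_sum_le_sum_abs _ _).trans (Finset.sum_le_sum fun a _ => ?_)
        have h1 : 0 ≤ (Pi.single α 1 : A → ℝ) a := (single_mem_stdSimplex ℝ α).1 a
        have h2 := hπ.nonneg q a
        split_ifs
        · rw [abs_mul]
          refine mul_le_mul ?_ ?_ (abs_nonneg _) M.horizon_pos.le
          · exact abs_sub_le_of_nonneg_of_le (meanOmc_nonneg M hπ hμ n q a)
              (meanOmc_le_horizon M hπ hμ n q a) (omc_nonneg M x q a) (omc_le_horizon M x q a)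
          · rw [abs_le]
            constructor <;> linarith
        · rw [abs_zero]
          exact mul_nonneg M.horizon_pos.le (add_nonneg h2 h1)
    _ = _ := by
        rw [← Finset.mul_sum, Finset.sum_add_distrib, hπ.sum_eq,
          (single_mem_stdSimplex ℝ α).2]
        ring

theorem sum_trajProb_noise [DecidableEq A] (M : MDP S A) (τ : ℝ) {π : S → A → ℝ}
    (hπ : IsPolicy π) {μ : S × A → ℝ} (hμ : μ ∈ stdSimplex ℝ (S × A)) (n : ℕ) (α : A) (q : S) :
    ∑ x : Fin n → S × A, trajProb M π μ x * noise M τ π μ α q x = 0 := by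
  simp only [noise, Finset.mul_sum]
  rw [Finset.sum_comm]
  refine Finset.sum_eq_zero fun a _ => ?_
  split_ifs
  · simp only [← mul_assoc, ← Finset.sum_mul, mul_sub, Finset.sum_sub_distrib]
    rw [(trajProb_mem M hπ hμ).2, one_mul, meanOmc, sub_self, zero_mul, zero_mul, sub_self]
  · simp

end Runs

/-! ### Regret under truncation and the self-sustaining lower bound on optimal actions. -/

section Regret

variable {S A : Type*} [Fintype S] [Fintype A] [DecidableEq S] [DecidableEq A]

/-- Advantage of the policy `π` over the action `α` for the action-values of `π`. -/
theorem value_sub_qValue (M : MDP S A) {π : S → A → ℝ} (hπ : IsPolicy π) (q : S) (α : A) :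
    value M π q - qValue M π q α =
      ∑ a, qValue M π q a * (π q a - (Pi.single α 1 : A → ℝ) a) := by
  rw [value_eq_sum_qValue M hπ]
  simp only [mul_sub, Finset.sum_sub_distrib, mul_comm (qValue M π q _) (π q _)]
  congr 1
  rw [Finset.sum_eq_single α] <;> simp +contextual

/-- Truncation costs nothing here. A truncated action differs from `α`, so its overestimate is
multiplied by `π q a ≥ 0` alone. At the others, the bias lies in `[0, b]`: it contributes at most `b
* π q a`, and its part at the vertex has the favorable sign. -/
theorem advantage_le_of_bias (M : MDP S A) {π : S → A → ℝ} (hπ : IsPolicy π) {τ b : ℝ}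
    (hb : 0 ≤ b) {μ : S × A → ℝ} (hμ : μ ∈ stdSimplex ℝ (S × A)) {n : ℕ} (x : Fin n → S × A)
    (q : S) (α : A) (hα : τ ≤ π q α)
    (hbias : ∀ a, τ ≤ π q a → qValue M π q a - meanOmc M π μ n q a ≤ b) :
    value M π q - qValue M π q α ≤
      ∑ a, tomc M τ π x q a * (π q a - (Pi.single α 1 : A → ℝ) a) +
        (noise M τ π μ α q x + b) := by
  have e : b = ∑ a, b * π q a := by rw [← Finset.mul_sum, hπ.sum_eq, mul_one]
  rw [value_sub_qValue M hπ, noise, e, ← Finset.sum_add_distrib, ← Finset.sum_add_distrib]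
  refine Finset.sum_le_sum fun a _ => ?_
  have h1 : 0 ≤ (Pi.single α 1 : A → ℝ) a := (single_mem_stdSimplex ℝ α).1 a
  have h2 := hπ.nonneg q a
  unfold tomc
  split_ifs with ha
  · have h3 := hbias a ha
    have h4 := meanOmc_le_qValue M hπ n hμ q a
    have h5 := mul_le_mul_of_nonneg_right h3 h2
    have h6 := mul_nonneg (sub_nonneg.2 h4) h1
    nlinarith
  · have hne : a ≠ α := by
      rintro rfl
      exact ha hα
    have h3 := mul_le_mul_of_nonneg_right (qValue_le_horizon M hπ q a) h2
    have h4 := mul_nonneg hb h2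
    rw [Pi.single_eq_of_ne hne]
    linarith

/-- Mirror descent whose one-step regret is controlled as long as the optimal actions keep
probability at least `τ`: these probabilities never fall below `τ`, and the cumulative regret is
bounded. -/
theorem sum_value_sub_le [Nonempty S] [Nonempty A] (M : MDP S A) {η τ b u B E : ℝ} (hη : 0 < η)
    (hb : 0 ≤ b) (hE : 0 ≤ E) {k : ℕ} {π : ℕ → S → A → ℝ}
    (hπ : ∀ t, IsPolicy (π t)) (hpos : ∀ t s a, 0 < π t s a) (h0 : π 0 = uniformPolicy)
    {Vs : S → ℝ} {α : S → A}
    (hVs : ∀ s, Vs s = M.c s (α s) + M.γ * ∑ s', M.P s (α s) s' * Vs s')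
    (hopt : ∀ t s, Vs s ≤ value M (π t) s) {N : ℕ → S → ℝ}
    (hN : ∀ T ≤ k, ∀ q, ∑ t ∈ Finset.range T, N t q ≤ u)
    (hstep : ∀ t < k, ∀ q, τ ≤ π t q (α q) →
      η * (value M (π t) q - qValue M (π t) q (α q)) ≤
        tsallisDiv (1 / 2) (Pi.single (α q) 1) (π t q) -
        tsallisDiv (1 / 2) (Pi.single (α q) 1) (π (t + 1) q) + E + η * (N t q + b))
    (hB : √(Fintype.card A) - 1 + k * E + η * (u + k * b) ≤ B)
    (hτ : τ * (1 + 2 * (B / (1 - M.γ))) ^ 2 ≤ 1) (s : S) :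
    ∑ t ∈ Finset.range k, (value M (π t) s - Vs s) ≤ B / (η * (1 - M.γ)) := by
  have hγ := M.one_sub_γ_pos
  set D : ℕ → S → ℝ := fun t q => tsallisDiv (1 / 2) (Pi.single (α q) 1) (π t q) with hD
  have hD0 : ∀ t q, 0 ≤ D t q := fun t q =>
    tsallisDiv_half_nonneg (single_mem_stdSimplex ℝ (α q)).1 (hpos t q)
  have hDinit : ∀ q, D 0 q = √(Fintype.card A) - 1 := fun q => by
    simp only [hD, h0, tsallisDiv_single_uniform]
  have hsum : ∀ T ≤ k, (∀ t < T, ∀ q, τ ≤ π t q (α q)) → ∀ q,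
      η * ∑ t ∈ Finset.range T, (value M (π t) q - qValue M (π t) q (α q)) ≤ B - D T q := by
    intro T hT hgood q
    have h1 := Finset.sum_le_sum fun t (ht : t ∈ Finset.range T) =>
      hstep t ((Finset.mem_range.1 ht).trans_le hT) q (hgood t (Finset.mem_range.1 ht) q)
    rw [← Finset.mul_sum, Finset.sum_add_distrib, Finset.sum_add_distrib,
      Finset.sum_range_sub' (fun t => D t q), ← Finset.mul_sum, Finset.sum_add_distrib,
      Finset.sum_const, Finset.sum_const, Finset.card_range, nsmul_eq_mul, nsmul_eq_mul,
      hDinit] at h1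
    have hTk : (T:ℝ) ≤ k := by exact_mod_cast hT
    have h2 := mul_le_mul_of_nonneg_right hTk hE
    have h3 := mul_le_mul_of_nonneg_left
      (add_le_add (hN T hT q) (mul_le_mul_of_nonneg_right hTk hb)) hη.le
    linarith
  have hU : ∀ T ≤ k, (∀ t < T, ∀ q, τ ≤ π t q (α q)) → ∀ q,
      ∑ t ∈ Finset.range T, (value M (π t) q - Vs q) ≤ B / (η * (1 - M.γ)) ∧
        D T q ≤ B / (1 - M.γ) := by
    intro T hT hgood
    set U : S → ℝ := fun q => ∑ t ∈ Finset.range T, (value M (π t) q - Vs q) with hUdef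
    have hU0 : ∀ q, 0 ≤ U q := fun q => Finset.sum_nonneg fun t _ => sub_nonneg.2 (hopt t q)
    -- The gap of each iterate splits into its advantage over `α q` and the discounted gap after one
    -- move under `α`. The transition is the same for all iterates, so the sums over time obey one
    -- recursion.
    have hUeq : ∀ q, U q = ∑ t ∈ Finset.range T, (value M (π t) q - qValue M (π t) q (α q)) +
        M.γ * ∑ s', M.P q (α q) s' * U s' := by
      intro q
      have e1 : ∀ t, value M (π t) q - Vs q = value M (π t) q - qValue M (π t) q (α q) +
          M.γ * ∑ s', M.P q (α q) s' * (value M (π t) s' - Vs s') := by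
        intro t
        have e2 := hVs q
        simp only [mul_sub, Finset.sum_sub_distrib, qValue]
        linarith
      simp only [hUdef, Finset.mul_sum (s := Finset.range T)]
      rw [Finset.sum_comm, Finset.sum_congr rfl fun t _ => e1 t,
        Finset.sum_add_distrib, Finset.mul_sum]
    have hc : B / (η * (1 - M.γ)) = B / η + M.γ * (B / (η * (1 - M.γ))) := by
      field_simp
      ring
    have hW : ∀ q, U q - B / (η * (1 - M.γ)) ≤
        -(D T q / η) + M.γ * ∑ s', M.P q (α q) s' * (U s' - B / (η * (1 - M.γ))) := by
      intro q
      have e1 := hsum T hT hgood q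
      rw [mul_comm, ← le_div_iff₀ hη, sub_div] at e1
      have e2 : ∑ s', M.P q (α q) s' * (U s' - B / (η * (1 - M.γ))) =
          ∑ s', M.P q (α q) s' * U s' - B / (η * (1 - M.γ)) := by
        simp only [mul_sub, Finset.sum_sub_distrib, ← Finset.sum_mul, (M.P_mem q (α q)).2, one_mul]
      rw [e2, hUeq q]
      linarith
    have hWn := nonpos_of_le_discounted M.γ_pos.le M.γ_lt_one (fun q => M.P_mem q (α q))
      (w := fun q => U q - B / (η * (1 - M.γ))) fun q => (hW q).trans (by
        have := div_nonneg (hD0 T q) hη.le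
        linarith)
    intro q
    refine ⟨sub_nonpos.1 (hWn q), ?_⟩
    have e1 := mul_nonpos_of_nonneg_of_nonpos M.γ_pos.le
      (sum_le_of_mem_stdSimplex (M.P_mem q (α q)) hWn)
    -- The summed advantage may be negative at a single state, so `hsum` alone does not bound the
    -- divergence. Nonnegativity of the summed gaps `U` does, at the price of a factor `1 / (1 -
    -- γ)`.
    have e2 : D T q / η ≤ B / (η * (1 - M.γ)) := by linarith [hW q, hU0 q]
    rw [div_le_iff₀ hη] at e2
    refine e2.trans (le_of_eq ?_)
    field_simp
  -- The bound on the divergence at time `T` needs the threshold only at earlier times, hence strong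
  -- induction; `hτ` turns that bound back into the threshold at time `T`.
  have hgood : ∀ T ≤ k, ∀ q, τ ≤ π T q (α q) := by
    intro T
    induction T using Nat.strong_induction_on with
    | _ T ih =>
      intro hT q
      have h1 := (hU T hT (fun t ht => ih t ht (ht.le.trans hT)) q).2
      have h2 := inv_sqrt_le_of_tsallisDiv (hpos T q) ((hπ T).sum_eq q) (α q)
      have h3 := Real.sqrt_pos.2 (hpos T q (α q))
      have h4 : (√(π T q (α q)))⁻¹ ≤ 1 + 2 * (B / (1 - M.γ)) := h2.trans (by
        have : tsallisDiv (1 / 2) (Pi.single (α q) 1) (π T q) ≤ B / (1 - M.γ) := h1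
        linarith)
      set G := 1 + 2 * (B / (1 - M.γ)) with hG
      have hG0 : 0 < G := (inv_pos.2 h3).trans_le h4
      have h5 : 1 ≤ √(π T q (α q)) * G := by
        have := mul_le_mul_of_nonneg_left h4 h3.le
        rwa [mul_inv_cancel₀ h3.ne'] at this
      have h6 : 1 ≤ π T q (α q) * G ^ 2 := by
        rw [← Real.sq_sqrt (hpos T q (α q)).le, ← mul_pow]
        exact one_le_pow₀ h5
      exact le_of_mul_le_mul_right (hτ.trans h6) (pow_pos hG0 2)
  exact (hU k le_rfl (fun t ht => hgood t ht.le) s).1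

end Regret

/-! ### Noise control uniformly over states and times. -/

section HighProbability

variable {S A : Type*} [Fintype S] [Fintype A]

/-- The inclusion is required only on outcomes of positive weight, since mixing is assumed almost
surely. -/
theorem runProb_mono [Nonempty A] (M : MDP S A) {η : ℝ} (hη : 0 ≤ η) (τ : ℝ) {k n : ℕ}
    {start : StartRule S A n} (hs : start.IsValid) {E F : Set (Fin k → Fin n → S × A)}
    (h : ∀ ξ ∈ E, 0 < runWeight M η τ start ξ → ξ ∈ F) :
    runProb M η τ start E ≤ runProb M η τ start F := by
  refine Finset.sum_le_sum fun ξ _ => ?_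
  have h0 : 0 ≤ runWeight M η τ start ξ := by
    rw [runWeight_eq_seqWeight]
    exact (seqWeight_mem (iterLaw_mem M hη τ hs)).1 ξ
  rcases h0.eq_or_lt with h1 | h1
  · rw [Set.indicator_apply_eq_zero.2 fun _ => h1.symm]
    exact Set.indicator_nonneg (fun ξ _ => by
      rw [runWeight_eq_seqWeight]
      exact (seqWeight_mem (iterLaw_mem M hη τ hs)).1 ξ) ξ
  · by_cases hE : ξ ∈ E
    · rw [Set.indicator_of_mem hE, Set.indicator_of_mem (h ξ hE h1)]
    · rw [Set.indicator_of_notMem hE]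
      exact Set.indicator_nonneg (fun ξ _ => by
        rw [runWeight_eq_seqWeight]
        exact (seqWeight_mem (iterLaw_mem M hη τ hs)).1 ξ) ξ

/-- Centered estimation error of iteration `t` along a run. -/
def runNoise [DecidableEq A] (M : MDP S A) (η τ : ℝ) {k n : ℕ} (start : StartRule S A n)
    (α : S → A) (ξ : Fin k → Fin n → S × A) (t : ℕ) (q : S) : ℝ :=
  if h : t < k then noise M τ (spmd M η τ ξ t)
    (start t fun i => ξ ⟨i, lt_trans i.isLt h⟩) (α q) q (ξ ⟨t, h⟩) else 0

theorem le_runProb_noise [Nonempty S] [Nonempty A] [DecidableEq A] (M : MDP S A) {η : ℝ}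
    (hη : 0 ≤ η) (τ : ℝ) {k n : ℕ} (hk : 1 ≤ k) {start : StartRule S A n} (hs : start.IsValid)
    (α : S → A) {δ : ℝ} (hδ0 : 0 < δ) (hδ1 : δ < 1) :
    1 - δ ≤ runProb M η τ start {ξ : Fin k → Fin n → S × A | ∀ q, ∀ T ≤ k,
      ∑ t ∈ Finset.range T, runNoise M η τ start α ξ t q ≤
        2 * (1 / (1 - M.γ)) * √(2 * k * Real.log (Fintype.card S * k / δ))} := by
  set R : ℝ := 2 * (1 / (1 - M.γ)) with hR
  have hR0 : 0 < R := mul_pos two_pos M.horizon_pos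
  have hk0 : (0:ℝ) < k := by exact_mod_cast hk
  have hS0 : (0:ℝ) < Fintype.card S := by exact_mod_cast Fintype.card_pos
  have hk1 : (1:ℝ) ≤ k := by exact_mod_cast hk
  have hS1 : (1:ℝ) ≤ Fintype.card S := by exact_mod_cast Fintype.card_pos (α := S)
  have hL : 0 ≤ Real.log (Fintype.card S * k / δ) :=
    Real.log_nonneg ((one_le_div hδ0).2 (hδ1.le.trans (one_le_mul_of_one_le_of_one_le hS1 hk1)))
  set u := R * √(2 * k * Real.log (Fintype.card S * k / δ)) with hu
  have hu0 : 0 ≤ u := by positivity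
  -- The index `(q, T)` carries the noise at `q` stopped after iteration `T`, that is, the partial
  -- sum of `T + 1` terms. The union bound has `|S| k` members, and `u` is set so that the total
  -- failure probability is exactly `δ`.
  have haz := azuma_union (ι := S × Fin k) (iterLaw_mem M hη τ hs)
    (Y := fun i t h x => if t ≤ (i.2 : ℕ) then
      noise M τ (spmd M η τ h t) (start t h) (α i.1) i.1 x else 0) hR0
    (fun i t h x => by
      split_ifs
      · exact abs_noise_le M τ (spmd_isPolicy M hη τ h t) (hs t h) _ _ x
      · rw [abs_zero]
        exact hR0.le)
    (fun i t h => by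
      split_ifs
      · exact sum_trajProb_noise M τ (spmd_isPolicy M hη τ h t) (hs t h) n _ _
      · simp) hk hu0
  have e1 : (Fintype.card (S × Fin k) : ℝ) * Real.exp (-(u ^ 2 / (2 * k * R ^ 2))) = δ := by
    have e2 : u ^ 2 / (2 * k * R ^ 2) = Real.log (Fintype.card S * k / δ) := by
      rw [hu, mul_pow, Real.sq_sqrt (by positivity)]
      field_simp
    rw [e2, Real.exp_neg, Real.exp_log (by positivity), Fintype.card_prod, Fintype.card_fin]
    push_cast
    field_simp
  rw [e1] at haz
  refine haz.trans ?_
  unfold runProb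
  rw [runWeight_eq_seqWeight]
  refine Finset.sum_le_sum fun ξ _ => ?_
  refine Set.indicator_le_indicator_of_subset (fun ξ hξ q T hT => ?_)
    (fun ξ => (seqWeight_mem (iterLaw_mem M hη τ hs)).1 ξ) ξ
  rcases T with _ | T
  · simpa using hu0
  · refine le_trans (le_of_eq ?_) (hξ (q, ⟨T, hT⟩))
    have e2 : ∀ t : Fin k, (if (t : ℕ) ≤ T then noise M τ
        (spmd M η τ (fun i : Fin t => ξ ⟨i, lt_trans i.isLt t.isLt⟩) t)
        (start t fun i : Fin t => ξ ⟨i, lt_trans i.isLt t.isLt⟩) (α q) q (ξ t) else 0) =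
        (fun t : ℕ => if t ≤ T then runNoise M η τ start α ξ t q else 0) t := by
      intro t
      simp only [runNoise, dif_pos t.isLt]
      rw [spmd_restrict M η τ ξ t.isLt.le le_rfl]
    rw [seqSum, Finset.sum_congr rfl fun t _ => e2 t, Fin.sum_univ_eq_sum_range
      (fun t : ℕ => if t ≤ T then runNoise M η τ start α ξ t q else 0) k, ← Finset.sum_filter]
    refine Finset.sum_congr ?_ fun _ _ => rfl
    ext t
    simp only [Finset.mem_range, Finset.mem_filter]
    omega

end HighProbability

/-! ### Trajectory length and elementary bounds on the parameters. -/

section Parameters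

variable {S A : Type*} [Fintype S] [Fintype A]

theorem four_le_log_of_le {x : ℝ} (hx : 64 ≤ x) : 4 ≤ Real.log x := by
  have h1 : Real.log 64 ≤ Real.log x := Real.log_le_log (by norm_num) hx
  have h2 : Real.log 64 = 6 * Real.log 2 := by
    rw [show (64:ℝ) = 2 ^ 6 by norm_num, Real.log_pow]
    norm_num
  linarith [Real.log_two_gt_d9]

/-- Along trajectories of length at least `16 H log (H |A| / ε)`, the on-policy Monte Carlo
estimate has bias at most `ε / 2` at all actions of probability at least `τ`. -/
theorem qValue_sub_meanOmc_le_eps [DecidableEq S] [Nonempty S] (M : MDP S A) {π : S → A → ℝ}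
    (h : IsPolicy π) {C ρ νmin τ ε H cA : ℝ} (hC : 1 ≤ C) (hρ0 : 0 < ρ) (hρ1 : ρ < 1)
    (hν0 : 0 < νmin) (hν1 : νmin ≤ 1) (hτ0 : 0 < τ) (hτ1 : τ ≤ 1) (hε : 0 < ε) (hcA : 1 ≤ cA)
    (hmix : MixesWith M π C ρ νmin)
    (hH : H = 1 / (1 - M.γ) + (⌈Real.logb ρ (νmin * τ / (2 * C))⌉ : ℝ) / (νmin * τ))
    (h64 : 64 ≤ H * cA / ε) {n : ℕ} (hn : 16 * (H * Real.log (H * cA / ε)) ≤ n) {s : S} {a : A}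
    (ha : τ ≤ π s a) {μ : S × A → ℝ} (hμ : μ ∈ stdSimplex ℝ (S × A)) :
    qValue M π s a - meanOmc M π μ n s a ≤ ε / 2 := by
  have hγ := M.one_sub_γ_pos
  have hντ : 0 < νmin * τ := mul_pos hν0 hτ0
  have hντ1 : νmin * τ ≤ 1 := mul_le_one₀ hν1 hτ0.le hτ1
  have hx0 : 0 < νmin * τ / (2 * C) := by positivity
  have hx1 : νmin * τ / (2 * C) < 1 := by
    rw [div_lt_one (by positivity)]
    linarith
  have hlog : 0 < Real.logb ρ (νmin * τ / (2 * C)) :=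
    Real.logb_pos_of_base_lt_one hρ0 hρ1 hx0 hx1
  obtain ⟨t, ht⟩ : ∃ t : ℕ, ⌈Real.logb ρ (νmin * τ / (2 * C))⌉ = (t : ℤ) + 1 :=
    ⟨(⌈Real.logb ρ (νmin * τ / (2 * C))⌉ - 1).toNat, by
      have := Int.ceil_pos.2 hlog
      omega⟩
  have htr : (⌈Real.logb ρ (νmin * τ / (2 * C))⌉ : ℝ) = (t : ℝ) + 1 := by exact_mod_cast ht
  rw [htr] at hH
  have ht1 : (0:ℝ) < (t:ℝ) + 1 := by positivity
  have hmixt : C * ρ ^ (t + 1) ≤ νmin / 2 := by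
    have e1 : ρ ^ (t + 1) ≤ νmin * τ / (2 * C) := by
      calc ρ ^ (t + 1) = ρ ^ ((t : ℝ) + 1) := by
            rw [← Real.rpow_natCast]
            push_cast
            rfl
        _ ≤ ρ ^ Real.logb ρ (νmin * τ / (2 * C)) :=
            Real.rpow_le_rpow_of_exponent_ge hρ0 hρ1.le (htr ▸ Int.le_ceil _)
        _ = _ := Real.rpow_logb hρ0 hρ1.ne hx0
    calc C * ρ ^ (t + 1) ≤ C * (νmin * τ / (2 * C)) := by gcongr
      _ = νmin * τ / 2 := by field_simp
      _ ≤ νmin / 2 := by nlinarith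
  have hMH : 1 / (1 - M.γ) ≤ H := by
    rw [hH]
    exact le_add_of_nonneg_right (by positivity)
  have hH1 : 1 ≤ (1 - M.γ) * H := by
    rw [div_le_iff₀ hγ] at hMH
    linarith
  have hH1' : 1 ≤ H := by nlinarith [M.γ_pos]
  have htH : (t:ℝ) + 1 ≤ νmin * τ * H := by
    have : ((t:ℝ) + 1) / (νmin * τ) ≤ H := by
      rw [hH]
      exact le_add_of_nonneg_left M.horizon_pos.le
    rw [div_le_iff₀ hντ] at this
    linarith
  set L := Real.log (H * cA / ε) with hL
  have hL4 : 4 ≤ L := four_le_log_of_le h64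
  have hHL : 4 ≤ H * L := by nlinarith
  -- About half of the trajectory is spent on `j` blocks of length `t + 1` waiting for a visit; the
  -- remaining `r`, at least about `n / 2`, collect cost.
  set j := n / (2 * (t + 1)) with hj
  have hj1 : 2 * (j * (t + 1)) ≤ n := by
    have := Nat.div_mul_le_self n (2 * (t + 1))
    rw [← hj] at this
    linarith
  have hj2 : n < (j + 1) * (2 * (t + 1)) := by
    have h1 := Nat.div_add_mod n (2 * (t + 1))
    have h2 := Nat.mod_lt n (show 0 < 2 * (t + 1) by omega)
    rw [← hj] at h1
    nlinarith
  have hn1 : 1 ≤ n := by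
    have : (1:ℝ) ≤ n := by linarith
    exact_mod_cast this
  obtain ⟨r, hr⟩ : ∃ r, n = j * (t + 1) + r + 1 := ⟨n - 1 - j * (t + 1), by omega⟩
  have hj1r : 2 * ((j:ℝ) * (t + 1)) ≤ n := by exact_mod_cast hj1
  have hj2r : (n:ℝ) ≤ (j + 1) * (2 * (t + 1)) := by exact_mod_cast hj2.le
  have hrr : (n:ℝ) = j * (t + 1) + r + 1 := by exact_mod_cast hr
  have hr2 : 2 * L ≤ (1 - M.γ) * r := by
    have h1 : 2 * (H * L) ≤ r := by linarith
    have h2 := mul_le_mul_of_nonneg_left h1 hγ.le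
    nlinarith
  have hj3 : 2 * L ≤ νmin * τ / 2 * j := by
    have h1 : 8 * (H * L) ≤ (j + 1) * ((t:ℝ) + 1) := by linarith
    have h2 := mul_le_mul_of_nonneg_left h1 hντ.le
    have h3 := mul_le_mul_of_nonneg_right htH (by linarith : (0:ℝ) ≤ 8 * L)
    have h4 : 8 * L * ((t:ℝ) + 1) ≤ (νmin * τ * (j + 1)) * ((t:ℝ) + 1) := by linarith
    have h5 := le_of_mul_le_mul_right h4 ht1
    linarith
  -- Both error terms are at most `exp (-L) ^ 2`. One factor `exp (-L) = ε / (H cA)` absorbs the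
  -- horizon, and the other is at most 1/64.
  have hexp : ∀ (y c : ℝ) (m : ℕ), 0 ≤ y → y ≤ 1 - c → 2 * L ≤ c * m →
      y ^ m ≤ Real.exp (-L) ^ 2 := by
    intro y c m hy0 hy hm
    calc y ^ m ≤ Real.exp (-c) ^ m :=
          pow_le_pow_left₀ hy0 (hy.trans (by linarith [Real.add_one_le_exp (-c)])) m
      _ = Real.exp (-(c * m)) := by
          rw [← Real.exp_nat_mul]
          congr 1
          ring
      _ ≤ Real.exp (-(2 * L)) := Real.exp_le_exp.2 (neg_le_neg hm)
      _ = _ := by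
          rw [← Real.exp_nat_mul]
          congr 1
          push_cast
          ring
  have hb1 := hexp M.γ (1 - M.γ) r M.γ_pos.le (by linarith) hr2
  have hb2 := hexp (1 - νmin * τ / 2) (νmin * τ / 2) j (by linarith) le_rfl hj3
  have hbias := qValue_sub_meanOmc_le_of_mixesWith M h hmix hτ0.le hmixt hν0.le hντ1 ha hμ j r
  rw [← hr] at hbias
  have hy : Real.exp (-L) = (H * cA / ε)⁻¹ := by
    rw [Real.exp_neg, Real.exp_log (by linarith)]
  have hy1 : Real.exp (-L) ≤ 1 / 64 := by
    rw [hy, ← one_div]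
    exact one_div_le_one_div_of_le (by norm_num) h64
  have hy2 : 1 / (1 - M.γ) * Real.exp (-L) ≤ ε := by
    have h1 : H ≤ H * cA := le_mul_of_one_le_right (by linarith) hcA
    rw [hy, inv_div, ← mul_div_assoc, div_le_iff₀ (by linarith), mul_comm]
    exact mul_le_mul_of_nonneg_left (hMH.trans h1) hε.le
  have hy0 := Real.exp_pos (-L)
  calc _ ≤ _ := hbias
    _ ≤ 1 / (1 - M.γ) * (Real.exp (-L) ^ 2 + Real.exp (-L) ^ 2) :=
        mul_le_mul_of_nonneg_left (add_le_add hb1 hb2) M.horizon_pos.le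
    _ = 2 * (1 / (1 - M.γ) * Real.exp (-L)) * Real.exp (-L) := by ring
    _ ≤ 2 * ε * (1 / 64) := mul_le_mul (by linarith) hy1 hy0.le (by linarith)
    _ ≤ ε / 2 := by linarith

section Scalars
variable {cS cA k : ℕ} {γ δ : ℝ}

theorem log_card_pos (hS : 1 ≤ cS) (hk : 1 ≤ k) (hδ0 : 0 < δ) (hδ1 : δ < 1) :
    0 < Real.log (cS * k / δ) := by
  have hk1 : (1:ℝ) ≤ k := by exact_mod_cast hk
  have hS1 : (1:ℝ) ≤ cS := by exact_mod_cast hS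
  exact Real.log_pos ((one_lt_div hδ0).2
    (hδ1.trans_le (one_le_mul_of_one_le_of_one_le hS1 hk1)))

theorem paramZ_nonneg (hγ1 : γ < 1) : 0 ≤ paramZ cS k γ δ := by
  have := sub_pos.2 hγ1
  unfold paramZ
  positivity

theorem paramEps_pos (hγ1 : γ < 1) (hS : 1 ≤ cS) (hk : 1 ≤ k) (hδ0 : 0 < δ) (hδ1 : δ < 1) :
    0 < paramEps cS k γ δ := by
  have h1 := log_card_pos hS hk hδ0 hδ1
  have h2 := sub_pos.2 hγ1
  have hk1 : (0:ℝ) < k := by exact_mod_cast hk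
  unfold paramEps
  positivity

theorem paramTau_pos (hγ1 : γ < 1) (hA : 1 ≤ cA) : 0 < paramTau cS cA k γ δ := by
  have h1 := paramZ_nonneg (cS := cS) (k := k) (δ := δ) hγ1
  have h2 := sub_pos.2 hγ1
  have h3 : (0:ℝ) < cA := by exact_mod_cast hA
  unfold paramTau
  positivity

/-- Thus `1 / √τ` is `(4 + 2Z) √|A| / (1 - γ)`, the form in which `τ` is compared with the
divergence bound. -/
theorem paramTau_mul_eq (hγ1 : γ < 1) (hA : 1 ≤ cA) : paramTau cS cA k γ δ *
    (1 / (1 - γ) * (4 + 2 * paramZ cS k γ δ) * √cA) ^ 2 = 1 := by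
  have h1 := paramZ_nonneg (cS := cS) (k := k) (δ := δ) hγ1
  have h2 := sub_pos.2 hγ1
  have h3 : (0:ℝ) < cA := by exact_mod_cast hA
  rw [mul_pow, Real.sq_sqrt h3.le]
  unfold paramTau
  field_simp

theorem paramTau_le_one (hγ0 : 0 < γ) (hγ1 : γ < 1) (hA : 1 ≤ cA) :
    paramTau cS cA k γ δ ≤ 1 := by
  have h1 := paramZ_nonneg (cS := cS) (k := k) (δ := δ) hγ1
  have h2 := sub_pos.2 hγ1
  have h3 : (1:ℝ) ≤ cA := by exact_mod_cast hA
  rw [← paramTau_mul_eq (cS := cS) (k := k) (δ := δ) hγ1 hA]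
  refine le_mul_of_one_le_right (paramTau_pos hγ1 hA).le (one_le_pow₀ ?_)
  have h4 : 1 ≤ 1 / (1 - γ) := (one_le_div h2).2 (by linarith)
  have h5 : 1 ≤ √(cA:ℝ) := Real.one_le_sqrt.2 h3
  exact one_le_mul_of_one_le_of_one_le (one_le_mul_of_one_le_of_one_le h4 (by linarith)) h5

theorem logb_arg_bounds {C νmin : ℝ} (hγ0 : 0 < γ) (hγ1 : γ < 1) (hA : 1 ≤ cA) (hC : 1 ≤ C)
    (hν0 : 0 < νmin) (hν1 : νmin ≤ 1) :
    0 < νmin * paramTau cS cA k γ δ / (2 * C) ∧ νmin * paramTau cS cA k γ δ / (2 * C) < 1 := by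
  have h1 := paramTau_pos (cS := cS) (k := k) (δ := δ) hγ1 hA
  have h2 := paramTau_le_one (cS := cS) (k := k) (δ := δ) hγ0 hγ1 hA
  refine ⟨by positivity, ?_⟩
  rw [div_lt_one (by positivity)]
  nlinarith

/-- Since `H ≥ 1 / τ ≥ (4 + 2Z)² ≥ 32 Z` and `ε ≤ Z / 2`, the ratio is at least 64. Hence the
logarithm in the trajectory length is never small. -/
theorem le_paramH_div {C ρ νmin : ℝ} (hγ0 : 0 < γ) (hγ1 : γ < 1) (hS : 1 ≤ cS)
    (hA : 1 ≤ cA) (hk : 1 ≤ k) (hδ0 : 0 < δ) (hδ1 : δ < 1) (hC : 1 ≤ C) (hρ0 : 0 < ρ)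
    (hρ1 : ρ < 1) (hν0 : 0 < νmin) (hν1 : νmin ≤ 1) :
    64 ≤ paramH cS cA k γ δ C ρ νmin * cA / paramEps cS k γ δ := by
  have hε := paramEps_pos hγ1 hS hk hδ0 hδ1
  have hZ := paramZ_nonneg (cS := cS) (k := k) (δ := δ) hγ1
  have h2 := sub_pos.2 hγ1
  have hτ := paramTau_pos (cS := cS) (k := k) (δ := δ) hγ1 hA
  have hA1 : (1:ℝ) ≤ cA := by exact_mod_cast hA
  have hk1 : (1:ℝ) ≤ k := by exact_mod_cast hk
  obtain ⟨hx0, hx1⟩ := logb_arg_bounds (cS := cS) (k := k) (δ := δ) hγ0 hγ1 hA hC hν0 hν1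
  have hc : (1:ℝ) ≤ ⌈Real.logb ρ (νmin * paramTau cS cA k γ δ / (2 * C))⌉ := by
    exact_mod_cast Int.one_le_ceil_iff.2 (Real.logb_pos_of_base_lt_one hρ0 hρ1 hx0 hx1)
  have hH : 1 / paramTau cS cA k γ δ ≤ paramH cS cA k γ δ C ρ νmin := by
    have h4 : 1 / paramTau cS cA k γ δ ≤
        (⌈Real.logb ρ (νmin * paramTau cS cA k γ δ / (2 * C))⌉ : ℝ) /
          (νmin * paramTau cS cA k γ δ) := by
      refine div_le_div₀ (by linarith) hc (by positivity) ?_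
      exact mul_le_of_le_one_left hτ.le hν1
    unfold paramH
    have : 0 < 1 / (1 - γ) := by positivity
    linarith
  have hτ2 : (4 + 2 * paramZ cS k γ δ) ^ 2 ≤ 1 / paramTau cS cA k γ δ := by
    rw [le_div_iff₀ hτ, ← paramTau_mul_eq (cS := cS) (k := k) (δ := δ) hγ1 hA, mul_comm]
    refine mul_le_mul_of_nonneg_left (pow_le_pow_left₀ (by positivity) ?_ 2) hτ.le
    have h4 : 1 ≤ 1 / (1 - γ) := (one_le_div h2).2 (by linarith)
    have h5 : 1 ≤ √(cA:ℝ) := Real.one_le_sqrt.2 hA1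
    exact (le_mul_of_one_le_left (by positivity) h4).trans
      (le_mul_of_one_le_right (by positivity) h5)
  have hεZ : paramEps cS k γ δ ≤ paramZ cS k γ δ / 2 := by
    unfold paramEps paramZ
    have h6 : √(Real.log (cS * k / δ) / k) ≤ √(Real.log (cS * k / δ)) :=
      Real.sqrt_le_sqrt (div_le_self (log_card_pos hS hk hδ0 hδ1).le hk1)
    have h7 := mul_le_mul_of_nonneg_left h6 (by positivity : (0:ℝ) ≤ 2 / (1 - γ))
    refine h7.trans (le_of_eq ?_)
    ring
  rw [le_div_iff₀ hε]
  have h8 : 0 < paramH cS cA k γ δ C ρ νmin := (by positivity : (0:ℝ) < _).trans_le hH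
  have h9 := le_mul_of_one_le_right h8.le hA1
  nlinarith [sq_nonneg (4 - 2 * paramZ cS k γ δ)]

end Scalars
end Parameters

/-! ### The high-probability bound for the best iterate. -/

section Main

variable {S A : Type*} [Fintype S] [Fintype A]

theorem paramEta_pos {cA k : ℕ} {γ : ℝ} (hγ1 : γ < 1) (hA : 2 ≤ cA) (hk : 1 ≤ k) :
    0 < paramEta cA k γ := by
  have h2 := sub_pos.2 hγ1
  have hA1 : (1:ℝ) < cA := by exact_mod_cast hA
  have hk1 : (0:ℝ) < k := by exact_mod_cast hk
  have h3 : 1 < (cA:ℝ) ^ (1 / 2 : ℝ) := Real.one_lt_rpow hA1 (by norm_num)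
  have h4 : 0 < (cA:ℝ) ^ (1 / 2 : ℝ) - 1 := sub_pos.2 h3
  unfold paramEta
  positivity

/-- Scalar estimates for the regret bound with `a = √|A|`, `θ = η M √k` and `w = √(log(|S|k/δ))`. -/
theorem regret_scalar {a θ w m : ℝ} (ha : 1 ≤ a) (hθ0 : 0 ≤ θ) (hθ : θ ^ 2 = (a - 1) / (2 * a ^ 2))
    (hw : 0 ≤ w) (hm : 1 ≤ m) :
    1 + 2 * (m * (a - 1 + 2 * θ ^ 2 + 4 * θ * w)) ≤ m * (4 + 2 * (4 * w * m)) * a ∧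
      (a - 1 + 2 * θ ^ 2) ≤ 4 * √(a ^ 3) * θ := by
  have ha0 : 0 < a := by linarith
  have h1 : 2 * a ^ 2 * θ ^ 2 = a - 1 := by
    rw [hθ]
    field_simp
  have hθ8 : θ ^ 2 ≤ 1 / 8 := by
    rw [hθ, div_le_div_iff₀ (by positivity) (by norm_num)]
    nlinarith [sq_nonneg (a - 2)]
  have hθ2 : θ ≤ 1 / 2 := by nlinarith
  have hθ3 : 2 * θ ^ 2 ≤ a - 1 := by
    rw [← h1]
    have : 1 ≤ a ^ 2 := one_le_pow₀ ha
    nlinarith [sq_nonneg θ]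
  constructor
  · have e1 : 4 * θ * w ≤ 2 * w := by nlinarith
    have e2 : w ≤ w * m * a := by
      have := le_mul_of_one_le_right hw (one_le_mul_of_one_le_of_one_le hm ha)
      linarith
    have e3 : 1 + 2 * (a - 1 + 2 * θ ^ 2 + 4 * θ * w) ≤ (4 + 2 * (4 * w * m)) * a := by
      nlinarith
    have e4 := mul_le_mul_of_nonneg_left e3 (by linarith : (0:ℝ) ≤ m)
    linarith
  · have hr0 := Real.sqrt_nonneg (a ^ 3)
    have hr : a ^ 2 * θ ≤ √(a ^ 3) := by
      refine Real.le_sqrt_of_sq_le ?_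
      have e1 : (a ^ 2 * θ) ^ 2 = a ^ 2 * (2 * a ^ 2 * θ ^ 2) / 2 := by ring
      rw [e1, h1]
      nlinarith [sq_nonneg a]
    have e2 := mul_le_mul_of_nonneg_right hr hθ0
    nlinarith

/-- The minimum is at most the average. As the hypothesis holds at every state, one event serves all
`ϑ` at once. -/
theorem bestGap_le_of_sum_le [DecidableEq S] (M : MDP S A) {η τ : ℝ} {k n : ℕ} (hk : 1 ≤ k)
    {ϑ : S → ℝ} (hϑ : ϑ ∈ stdSimplex ℝ S) (πs : S → A → ℝ) (ξ : Fin k → Fin n → S × A) {G : ℝ}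
    (h : ∀ s, ∑ t ∈ Finset.range k, (value M (spmd M η τ ξ t) s - value M πs s) ≤ k * G) :
    bestGap M η τ ϑ πs ξ ≤ G := by
  have hk0 : (0:ℝ) < k := by exact_mod_cast hk
  have : Nonempty (Fin k) := ⟨⟨0, hk⟩⟩
  set m := ⨅ t : Fin k, objective M ϑ (spmd M η τ ξ t) with hm
  have h1 : ∀ t : Fin k, m ≤ objective M ϑ (spmd M η τ ξ t) :=
    fun t => ciInf_le (Set.finite_range _).bddBelow t
  have h2 : k * m ≤ ∑ t ∈ Finset.range k, objective M ϑ (spmd M η τ ξ t) := by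
    rw [← Fin.sum_univ_eq_sum_range (fun t => objective M ϑ (spmd M η τ ξ t)) k]
    have := Finset.sum_le_sum fun (t : Fin k) (_ : t ∈ Finset.univ) => h1 t
    simpa using this
  have h3 := sum_le_of_mem_stdSimplex hϑ h
  have h4 : ∑ s, ϑ s * ∑ t ∈ Finset.range k, (value M (spmd M η τ ξ t) s - value M πs s) =
      ∑ t ∈ Finset.range k, objective M ϑ (spmd M η τ ξ t) - k * objective M ϑ πs := by
    simp only [objective, Finset.mul_sum, mul_sub, Finset.sum_sub_distrib]
    rw [Finset.sum_comm]
    simp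
  rw [h4] at h3
  have h5 : k * (m - objective M ϑ πs) ≤ k * G := by linarith
  exact le_of_mul_le_mul_left h5 hk0

theorem IsPolicy.eq_of_subsingleton [Subsingleton A] {π π' : S → A → ℝ}
    (h : IsPolicy π) (h' : IsPolicy π') : π = π' := by
  funext s a
  have e1 := h.sum_eq s
  have e2 := h'.sum_eq s
  rw [Fintype.sum_subsingleton _ a] at e1 e2
  rw [e1, e2]

/-- High-probability bound on the optimality gap of the best iterate. -/
theorem le_runProb_bestGap [DecidableEq S] [Nonempty S] [Nonempty A]
    {γ C ρ νmin δ : ℝ} (hγ0 : 0 < γ) (hγ1 : γ < 1) (hC : 1 ≤ C) (hρ0 : 0 < ρ) (hρ1 : ρ < 1)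
    (hν0 : 0 < νmin) (hν1 : νmin ≤ 1) (hδ0 : 0 < δ) (hδ1 : δ < 1) {k n : ℕ} (hk : 1 ≤ k)
    (hn : 16 * (paramH (Fintype.card S) (Fintype.card A) k γ δ C ρ νmin *
      Real.log (paramH (Fintype.card S) (Fintype.card A) k γ δ C ρ νmin *
        Fintype.card A / paramEps (Fintype.card S) k γ δ)) ≤ n)
    (M : MDP S A) (hM : M.γ = γ) {start : StartRule S A n} (hs : start.IsValid)
    (hmix : RunMixes M (paramEta (Fintype.card A) k γ)
      (paramTau (Fintype.card S) (Fintype.card A) k γ δ) k start C ρ νmin)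
    {πs : S → A → ℝ} (hopt : IsOptimalPolicy M πs) :
    1 - δ ≤ runProb M (paramEta (Fintype.card A) k γ)
      (paramTau (Fintype.card S) (Fintype.card A) k γ δ) start
      {ξ : Fin k → Fin n → S × A | ∀ ϑ ∈ stdSimplex ℝ S,
        bestGap M (paramEta (Fintype.card A) k γ)
          (paramTau (Fintype.card S) (Fintype.card A) k γ δ) ϑ πs ξ ≤
        4 * (1 / (1 - γ)) / (1 - γ) * √((Fintype.card A : ℝ) ^ (3 / 2 : ℝ) / k) +
          4 * √(Real.log (Fintype.card S * k / δ)) / ((1 - γ) ^ 2 * √k)} := by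
  classical
  have hS : 1 ≤ Fintype.card S := Fintype.card_pos
  have hA : 1 ≤ Fintype.card A := Fintype.card_pos
  have hη0 : 0 ≤ paramEta (Fintype.card A) k γ := Real.sqrt_nonneg _
  have hγ := sub_pos.2 hγ1
  have hk0 : (0:ℝ) < k := by exact_mod_cast hk
  have hL := log_card_pos hS hk hδ0 hδ1
  set η := paramEta (Fintype.card A) k γ with hη
  set τ := paramTau (Fintype.card S) (Fintype.card A) k γ δ with hτ
  obtain ⟨α, hα⟩ := hopt.exists_det
  refine (le_runProb_noise M hη0 τ hk hs α hδ0 hδ1).trans (runProb_mono M hη0 τ hs ?_)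
  intro ξ hξ hwξ ϑ hϑ
  have hpol := spmd_isPolicy M hη0 τ ξ
  refine bestGap_le_of_sum_le M hk hϑ πs ξ fun s => ?_
  -- With a single action the stepsize is 0 and cannot be divided by, but all policies coincide.
  rcases hA.eq_or_lt with hA1 | hA2
  · have : Subsingleton A := Fintype.card_le_one_iff_subsingleton.1 hA1.ge
    rw [Finset.sum_eq_zero fun t _ => by
      rw [IsPolicy.eq_of_subsingleton (hpol t) hopt.1, sub_self]]
    positivity
  have hηpos : 0 < η := paramEta_pos hγ1 hA2 hk
  set m := 1 / (1 - γ) with hm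
  have hm1 : 1 ≤ m := (one_le_div hγ).2 (by linarith)
  set a := √(Fintype.card A : ℝ) with ha
  set w := √(Real.log (Fintype.card S * k / δ)) with hw
  have hA0 : (0:ℝ) < Fintype.card A := by exact_mod_cast hA
  have ha1 : 1 ≤ a := Real.one_le_sqrt.2 (by exact_mod_cast hA)
  have ha2 : (Fintype.card A : ℝ) = a ^ 2 := (Real.sq_sqrt hA0.le).symm
  have hsk := Real.sqrt_pos.2 hk0
  have hskk := Real.sq_sqrt hk0.le
  set κ := √(k:ℝ) with hκ
  set θ := η * m * κ with hθ
  have hθ0 : 0 < θ := by positivity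
  have hη2 : η ^ 2 = (a - 1) / (2 * a ^ 2 * m ^ 2 * k) := by
    rw [hη, paramEta, Real.sq_sqrt, ← Real.sqrt_eq_rpow, ← ha2]
    rw [← Real.sqrt_eq_rpow]
    exact div_nonneg (sub_nonneg.2 ha1) (by positivity)
  have hθ2 : θ ^ 2 = (a - 1) / (2 * a ^ 2) := by
    rw [hθ, mul_pow, mul_pow, hη2, hskk]
    field_simp
  obtain ⟨hsc1, hsc2⟩ := regret_scalar (w := w) ha1 hθ0.le hθ2 (Real.sqrt_nonneg _) hm1
  set ε := paramEps (Fintype.card S) k γ δ with hε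
  have hε0 : 0 < ε := paramEps_pos hγ1 hS hk hδ0 hδ1
  have hεeq : ε / 2 = m * (w / κ) := by
    rw [hε, paramEps, Real.sqrt_div hL.le, hm]
    ring
  set u := 2 * (1 / (1 - M.γ)) * √(2 * k * Real.log (Fintype.card S * k / δ)) with hu
  -- Azuma gives the constant `2 √2 ≤ 3`; the bias adds `k ε / 2 = m κ w`, whence the 4 in the bound
  -- `B`.
  have hueq : u ≤ 3 * m * (κ * w) := by
    rw [hu, hM, Real.sqrt_mul (by positivity), Real.sqrt_mul (by positivity)]
    have h2 : 2 * √2 ≤ 3 := by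
      have := Real.sqrt_le_sqrt (show (2:ℝ) ≤ (3 / 2) ^ 2 by norm_num)
      rw [Real.sqrt_sq (by norm_num)] at this
      linarith
    have h3 := mul_le_mul_of_nonneg_right h2 (by positivity : 0 ≤ m * (κ * w))
    rw [← hm, ← hκ, ← hw]
    linarith
  have hkw : k * (m * (w / κ)) = m * (κ * w) := by
    rw [← hskk]
    field_simp
  have hB : a - 1 + k * (2 * η ^ 2 * m ^ 2) + η * (u + k * (ε / 2)) ≤
      a - 1 + 2 * θ ^ 2 + 4 * θ * w := by
    have h1 : k * (2 * η ^ 2 * m ^ 2) = 2 * θ ^ 2 := by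
      rw [hθ, mul_pow, mul_pow, hskk]
      ring
    have h2 : η * (u + k * (ε / 2)) ≤ η * (4 * m * (κ * w)) := by
      refine mul_le_mul_of_nonneg_left ?_ hηpos.le
      rw [hεeq, hkw]
      linarith
    have h3 : η * (4 * m * (κ * w)) = 4 * θ * w := by
      rw [hθ]
      ring
    linarith
  have hτ1 : τ * (1 + 2 * ((a - 1 + 2 * θ ^ 2 + 4 * θ * w) / (1 - M.γ))) ^ 2 ≤ 1 := by
    have h1 := paramTau_mul_eq (cS := Fintype.card S) (k := k) (δ := δ) hγ1 hA
    refine le_of_le_of_eq ?_ h1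
    rw [hM]
    refine mul_le_mul_of_nonneg_left (pow_le_pow_left₀ ?_ ?_ 2) (paramTau_pos hγ1 hA).le
    · have : 0 ≤ a - 1 := sub_nonneg.2 ha1
      positivity
    · have h2 : paramZ (Fintype.card S) k γ δ = 4 * w * m := by
        rw [paramZ, hm]
        ring
      rw [h2, div_eq_mul_one_div, ← hm, mul_comm _ m]
      exact hsc1
  have key := sum_value_sub_le M (τ := τ) (b := ε / 2) (u := u) (E := 2 * η ^ 2 * m ^ 2) hηpos
    (by positivity) (by positivity) hpol (spmd_pos M hη0 τ ξ) rfl (Vs := value M πs) (α := α)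
    hα (fun t s => hopt.2 _ (hpol t) s) (N := runNoise M η τ start α ξ) (fun T hT q => hξ q T hT)
    (fun t ht q hq => by
      have hst := hs t fun i => ξ ⟨i, lt_trans i.isLt ht⟩
      have h1 := advantage_le_of_bias M (hpol t) (by positivity : 0 ≤ ε / 2) hst (ξ ⟨t, ht⟩) q
        (α q) hq fun a ha => qValue_sub_meanOmc_le_eps M (hpol t) hC hρ0 hρ1 hν0 hν1
          (paramTau_pos hγ1 hA) (paramTau_le_one hγ0 hγ1 hA) hε0 (by exact_mod_cast hA)
          (hmix ξ hwξ t ht.le) (by rw [hM]; rfl)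
          (le_paramH_div hγ0 hγ1 hS hA hk hδ0 hδ1 hC hρ0 hρ1 hν0 hν1) hn ha hst
      have h2 := mirrorStep_regret (s := q) hη0
        (tomc_nonneg M τ (spmd M η τ ξ t) (ξ ⟨t, ht⟩) q)
        (tomc_le_horizon M τ (spmd M η τ ξ t) (ξ ⟨t, ht⟩) q) (spmd_pos M hη0 τ ξ t q)
        ((hpol t).sum_eq q) (single_mem_stdSimplex ℝ (α q))
      rw [← spmd_succ M η τ ξ ht, hM] at h2
      have h3 := mul_le_mul_of_nonneg_left h1 hη0
      simp only [runNoise, dif_pos ht]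
      linarith)
    hB hτ1 s
  refine key.trans ?_
  have hr : (Fintype.card A : ℝ) ^ (3 / 2 : ℝ) = a ^ 3 := by
    rw [ha, Real.sqrt_eq_rpow, ← Real.rpow_natCast, ← Real.rpow_mul hA0.le]
    norm_num
  rw [hr, Real.sqrt_div (by positivity), hM]
  have h1 : (a - 1 + 2 * θ ^ 2 + 4 * θ * w) / (η * (1 - γ)) ≤
      (4 * √(a ^ 3) * θ + 4 * θ * w) / (η * (1 - γ)) := by gcongr
  refine h1.trans (le_of_eq ?_)
  rw [← hκ, ← hskk, hθ, hm]
  field_simp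

end Main

/-! ### Choice of the sample sizes for a given accuracy. -/

section SampleComplexity

variable {cS cA : ℕ} {γ δ ϵ Λ : ℝ}

/-- Choice of the number of iterations for the accuracy `ϵ`. -/
theorem exists_iterations (hS : 1 ≤ cS) (hA : 1 ≤ cA) {m : ℝ} (hm : 1 ≤ m) (hδ0 : 0 < δ)
    (hδ1 : δ < 1) (hϵ0 : 0 < ϵ) (hϵ1 : ϵ ≤ m) (hΛ9 : 9 ≤ Λ) (hSΛ : cS ≤ Λ) (hAΛ : cA ≤ Λ)
    (hmΛ : m ≤ Λ) (hδΛ : 1 / δ ≤ Λ) (hϵΛ : 1 / ϵ ≤ Λ) :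
    ∃ k : ℕ, 1 ≤ k ∧
      64 * m ^ 4 * ((cA : ℝ) ^ (3 / 2 : ℝ) + Real.log (cS * k / δ)) ≤ k * ϵ ^ 2 ∧
      k * ϵ ^ 2 ≤ 128 * m ^ 4 * ((cA : ℝ) ^ (3 / 2 : ℝ) + Real.log (cS * k / δ)) ∧
      (k : ℝ) ≤ Λ ^ 24 := by
  classical
  have hA1 : (1:ℝ) ≤ cA := by exact_mod_cast hA
  have hS1 : (1:ℝ) ≤ cS := by exact_mod_cast hS
  have hAr1 : (1:ℝ) ≤ (cA : ℝ) ^ (3 / 2 : ℝ) := Real.one_le_rpow hA1 (by norm_num)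
  have hAr2 : (cA : ℝ) ^ (3 / 2 : ℝ) ≤ (cA : ℝ) ^ 2 := by
    rw [← Real.rpow_natCast]
    exact Real.rpow_le_rpow_of_exponent_le hA1 (by norm_num)
  set K : ℝ := 64 * m ^ 4 / ϵ ^ 2 with hK
  have hK0 : 0 < K := by positivity
  set y : ℝ := K * ((cA : ℝ) ^ 2 + cS / δ + 2) with hy
  have hy0 : 0 < y := by positivity
  set q : ℕ := ⌈y⌉₊ with hq
  have hqy : y ≤ q := Nat.le_ceil y
  have hq1 : 1 ≤ q := Nat.one_le_ceil_iff.2 hy0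
  have hq1r : (1:ℝ) ≤ q := by exact_mod_cast hq1
  -- The logarithm at `k = q²` grows at most linearly in `q`, so the square is large enough to
  -- satisfy the implicit condition on `k`.
  have hlogq : Real.log (cS * ((q ^ 2 : ℕ) : ℝ) / δ) ≤ cS / δ + 2 * q := by
    have e1 : cS * ((q ^ 2 : ℕ) : ℝ) / δ = cS / δ * (q:ℝ) ^ 2 := by
      push_cast
      ring
    have e2 : (0:ℝ) < cS / δ := by positivity
    rw [e1, Real.log_mul e2.ne' (by positivity), Real.log_pow]
    have e3 := Real.log_le_sub_one_of_pos e2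
    have e4 := Real.log_le_sub_one_of_pos (by linarith : (0:ℝ) < q)
    push_cast
    linarith
  set P : ℕ → Prop := fun k => 1 ≤ k ∧
    64 * m ^ 4 * ((cA : ℝ) ^ (3 / 2 : ℝ) + Real.log (cS * k / δ)) ≤ k * ϵ ^ 2 with hP
  have hPq : P (q ^ 2) := by
    refine ⟨Nat.one_le_pow _ _ hq1, ?_⟩
    have e1 : 64 * m ^ 4 = K * ϵ ^ 2 := by
      rw [hK]
      field_simp
    have e2 : K * ((cA : ℝ) ^ (3 / 2 : ℝ) + Real.log (cS * ((q ^ 2 : ℕ) : ℝ) / δ)) ≤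
        (q:ℝ) ^ 2 := by
      have f1 : (cA : ℝ) ^ (3 / 2 : ℝ) + Real.log (cS * ((q ^ 2 : ℕ) : ℝ) / δ) ≤
          ((cA : ℝ) ^ 2 + cS / δ + 2) * q := by
        have f2 : (0:ℝ) ≤ (cA : ℝ) ^ 2 + cS / δ := by positivity
        nlinarith
      have f3 := mul_le_mul_of_nonneg_left f1 hK0.le
      have f4 := mul_le_mul_of_nonneg_right hqy (by linarith : (0:ℝ) ≤ q)
      rw [hy] at f4
      linarith
    have e3 := mul_le_mul_of_nonneg_right e2 (sq_nonneg ϵ)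
    rw [e1]
    push_cast at e3 ⊢
    linarith
  have hex : ∃ k, P k := ⟨_, hPq⟩
  obtain ⟨hk1, hk2⟩ := Nat.find_spec hex
  -- Minimality gives the matching upper bound: the condition fails at `k - 1 ≥ k / 2`, so the
  -- constant at most doubles. If `k = 1`, the assumption `ϵ ≤ m` is used instead.
  refine ⟨Nat.find hex, hk1, hk2, ?_, ?_⟩
  · set k := Nat.find hex with hk
    have hlog := log_card_pos hS hk1 hδ0 hδ1
    rcases hk1.eq_or_lt with h1 | h1
    · rw [← h1] at hlog ⊢
      have e1 : ϵ ^ 2 ≤ m ^ 2 := pow_le_pow_left₀ hϵ0.le hϵ1 2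
      have e2 : m ^ 2 ≤ m ^ 4 := pow_le_pow_right₀ hm (by norm_num)
      have e3 : m ^ 4 ≤ m ^ 4 *
          ((cA : ℝ) ^ (3 / 2 : ℝ) + Real.log (cS * ((1:ℕ) : ℝ) / δ)) :=
        le_mul_of_one_le_right (by positivity) (by linarith)
      have e4 : 0 < m ^ 4 := by positivity
      rw [Nat.cast_one] at e3 ⊢
      linarith
    · obtain ⟨j, hj⟩ : ∃ j, k = j + 1 := ⟨k - 1, by omega⟩
      have hj1 : 1 ≤ j := by omega
      have hnot : ¬ P j := Nat.find_min hex (by omega)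
      have e1 : (j:ℝ) * ϵ ^ 2 < 64 * m ^ 4 *
          ((cA : ℝ) ^ (3 / 2 : ℝ) + Real.log (cS * j / δ)) := by
        by_contra hcon
        exact hnot ⟨hj1, not_lt.1 hcon⟩
      have hjr : (1:ℝ) ≤ j := by exact_mod_cast hj1
      have e2 : Real.log (cS * j / δ) ≤ Real.log (cS * k / δ) := by
        refine Real.log_le_log (by positivity) ?_
        rw [hj]
        push_cast
        gcongr
        linarith
      have e3 := mul_le_mul_of_nonneg_left e2 (by positivity : 0 ≤ 64 * m ^ 4)
      have e4 : (k:ℝ) ≤ 2 * j := by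
        rw [hj]
        push_cast
        linarith
      have e5 := mul_le_mul_of_nonneg_right e4 (sq_nonneg ϵ)
      linarith
  · have e1 : (Nat.find hex : ℝ) ≤ (q:ℝ) ^ 2 := by exact_mod_cast Nat.find_min' hex hPq
    refine e1.trans ?_
    have hΛ0 : 0 < Λ := by linarith
    have hm4 : m ^ 4 ≤ Λ ^ 4 := pow_le_pow_left₀ (by linarith) hmΛ 4
    have hϵ2 : (1 / ϵ) ^ 2 ≤ Λ ^ 2 := pow_le_pow_left₀ (by positivity) hϵΛ 2
    have hKΛ : K ≤ Λ ^ 8 := by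
      have f1 : K = 64 * (m ^ 4 * (1 / ϵ) ^ 2) := by
        rw [hK]
        field_simp
      have f2 : m ^ 4 * (1 / ϵ) ^ 2 ≤ Λ ^ 4 * Λ ^ 2 := mul_le_mul hm4 hϵ2 (by positivity)
        (by positivity)
      have f3 : (64:ℝ) ≤ Λ ^ 2 := by nlinarith
      have f4 := mul_le_mul f3 f2 (by positivity) (by positivity)
      rw [f1]
      refine f4.trans (le_of_eq (by ring))
    have hyΛ : (cA : ℝ) ^ 2 + cS / δ + 2 ≤ Λ ^ 3 := by
      have f1 : (cA : ℝ) ^ 2 ≤ Λ ^ 2 := pow_le_pow_left₀ (by linarith) hAΛ 2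
      have f2 : (cS : ℝ) * (1 / δ) ≤ Λ * Λ := mul_le_mul hSΛ hδΛ (by positivity) hΛ0.le
      have f3 : (cS : ℝ) / δ = cS * (1 / δ) := by ring
      have f4 : 9 * Λ ^ 2 ≤ Λ ^ 3 := by
        have := mul_le_mul_of_nonneg_right hΛ9 (sq_nonneg Λ)
        linarith
      nlinarith
    have hqΛ : (q:ℝ) ≤ Λ ^ 12 := by
      have f1 := (Nat.ceil_lt_add_one hy0.le).le
      have f2 : y ≤ Λ ^ 8 * Λ ^ 3 := mul_le_mul hKΛ hyΛ (by positivity) (by positivity)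
      have f3 : 1 ≤ Λ ^ 11 := one_le_pow₀ (by linarith)
      have f4 := mul_le_mul_of_nonneg_right hΛ9 (by linarith : 0 ≤ Λ ^ 11)
      calc (q:ℝ) ≤ Λ ^ 8 * Λ ^ 3 + 1 := f1.trans (by linarith)
        _ = Λ ^ 11 + 1 := by ring
        _ ≤ Λ * Λ ^ 11 := by linarith
        _ = Λ ^ 12 := by ring
    calc (q:ℝ) ^ 2 ≤ (Λ ^ 12) ^ 2 := pow_le_pow_left₀ (by linarith) hqΛ 2
      _ = Λ ^ 24 := by ring

theorem optimality_bound_le {a w m k : ℝ} (hk : 0 < k) (ha : 0 ≤ a) (hw : 0 ≤ w) (hm : 0 < m)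
    (hϵ0 : 0 < ϵ) (h : 64 * m ^ 4 * (a + w) ≤ k * ϵ ^ 2) :
    4 * m * m * √(a / k) + 4 * √w * m ^ 2 / √k ≤ ϵ := by
  have h1 : ∀ x, 0 ≤ x → x ≤ a + w → 4 * m ^ 2 * √(x / k) ≤ ϵ / 2 := by
    intro x hx0 hx
    have e1 : √(x / k) ≤ ϵ / (8 * m ^ 2) := by
      refine Real.sqrt_le_iff.2 ⟨by positivity, ?_⟩
      rw [div_le_iff₀ hk, div_pow, div_mul_eq_mul_div, le_div_iff₀ (by positivity)]
      have := mul_le_mul_of_nonneg_left hx (by positivity : 0 ≤ 64 * m ^ 4)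
      nlinarith
    calc 4 * m ^ 2 * √(x / k) ≤ 4 * m ^ 2 * (ϵ / (8 * m ^ 2)) := by gcongr
      _ = ϵ / 2 := by
        field_simp
        norm_num
  have h2 := h1 a ha (by linarith)
  have h3 := h1 w hw (by linarith)
  rw [Real.sqrt_div hw] at h3
  have e1 : 4 * √w * m ^ 2 / √k = 4 * m ^ 2 * (√w / √k) := by ring
  rw [e1]
  linarith

/-- The effective trajectory length is controlled by the mixing time. -/
theorem paramH_le {C ρ νmin : ℝ} {k : ℕ} (hγ0 : 0 < γ) (hγ1 : γ < 1) (hA : 1 ≤ cA) (hC : 1 ≤ C)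
    (hρ0 : 0 < ρ) (hρ1 : ρ < 1) (hν0 : 0 < νmin) (hν1 : νmin ≤ 1) :
    paramH cS cA k γ δ C ρ νmin ≤ 20 * (1 / (1 - γ) + paramTmix cS cA k γ δ C ρ νmin *
      (2 + paramZ cS k γ δ) ^ 2 * cA / (νmin * (1 - γ) ^ 2)) ∧
    0 < paramTmix cS cA k γ δ C ρ νmin ∧
    paramTmix cS cA k γ δ C ρ νmin ≤ (2 + paramZ cS k γ δ) ^ 2 * C * cA /
      (2 * νmin * (1 - γ) ^ 2) * (1 / (1 - ρ)) + 1 := by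
  have hZ := paramZ_nonneg (cS := cS) (k := k) (δ := δ) hγ1
  have hγ := sub_pos.2 hγ1
  have hρ := sub_pos.2 hρ1
  have hA1 : (1:ℝ) ≤ cA := by exact_mod_cast hA
  set Z := paramZ cS k γ δ with hZdef
  set X : ℝ := 2 * νmin * (1 - γ) ^ 2 / ((2 + Z) ^ 2 * C * cA) with hX
  have hX0 : 0 < X := by positivity
  have hX1 : X ≤ 1 / 2 := by
    rw [hX, div_le_div_iff₀ (by positivity) (by norm_num)]
    have e1 : (1 - γ) ^ 2 ≤ 1 := pow_le_one₀ hγ.le (by linarith)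
    have e2 : νmin * (1 - γ) ^ 2 ≤ 1 := mul_le_one₀ hν1 (sq_nonneg _) e1
    have e3 : 4 ≤ (2 + Z) ^ 2 := by nlinarith
    have e4 : (2 + Z) ^ 2 ≤ (2 + Z) ^ 2 * (C * cA) :=
      le_mul_of_one_le_right (by positivity) (one_le_mul_of_one_le_of_one_le hC hA1)
    linarith
  have hlog : 0 < Real.logb ρ X := Real.logb_pos_of_base_lt_one hρ0 hρ1 hX0 (by linarith)
  have hTmix : paramTmix cS cA k γ δ C ρ νmin = (⌈Real.logb ρ X⌉ : ℝ) := rfl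
  have hT0 : (0:ℝ) < (⌈Real.logb ρ X⌉ : ℝ) := by exact_mod_cast Int.ceil_pos.2 hlog
  rw [hTmix]
  refine ⟨?_, hT0, ?_⟩
  · have hτ : νmin * paramTau cS cA k γ δ =
        νmin * (1 - γ) ^ 2 / (4 * (2 + Z) ^ 2 * cA) := by
      unfold paramTau
      rw [← hZdef]
      have : (4 + 2 * Z) ^ 2 = 4 * (2 + Z) ^ 2 := by ring
      rw [this]
      field_simp
    -- As `X ≤ 1 / 2`, each factor 1/2 adds at most one `logb ρ X`, for a total of five; with the 4
    -- from `1 / τ` this gives the constant 20.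
    have harg : νmin * paramTau cS cA k γ δ / (2 * C) = X * (1 / 2) ^ 4 := by
      rw [hτ, hX]
      field_simp
      norm_num
    have hceil : (⌈Real.logb ρ (νmin * paramTau cS cA k γ δ / (2 * C))⌉ : ℝ) ≤
        5 * (⌈Real.logb ρ X⌉ : ℝ) := by
      have e1 : Real.logb ρ (νmin * paramTau cS cA k γ δ / (2 * C)) ≤ 5 * Real.logb ρ X := by
        rw [harg, Real.logb_mul hX0.ne' (by positivity), Real.logb_pow]
        have e2 : Real.logb ρ (1 / 2) ≤ Real.logb ρ X :=
          (Real.logb_le_logb_of_base_lt_one hρ0 hρ1 (by norm_num) hX0).2 hX1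
        push_cast
        linarith
      have e3 : ⌈Real.logb ρ (νmin * paramTau cS cA k γ δ / (2 * C))⌉ ≤
          5 * ⌈Real.logb ρ X⌉ := by
        refine Int.ceil_le.2 (e1.trans ?_)
        push_cast
        linarith [Int.le_ceil (Real.logb ρ X)]
      exact_mod_cast e3
    unfold paramH
    have e4 : (⌈Real.logb ρ (νmin * paramTau cS cA k γ δ / (2 * C))⌉ : ℝ) /
        (νmin * paramTau cS cA k γ δ) ≤ 5 * (⌈Real.logb ρ X⌉ : ℝ) /
        (νmin * paramTau cS cA k γ δ) :=
      div_le_div_of_nonneg_right hceil (mul_pos hν0 (paramTau_pos hγ1 hA)).le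
    have e5 : 5 * (⌈Real.logb ρ X⌉ : ℝ) / (νmin * paramTau cS cA k γ δ) =
        20 * ((⌈Real.logb ρ X⌉ : ℝ) * (2 + Z) ^ 2 * cA / (νmin * (1 - γ) ^ 2)) := by
      rw [hτ]
      field_simp
      norm_num
    have e6 : 0 < 1 / (1 - γ) := by positivity
    linarith
  · have e1 := (Int.ceil_lt_add_one (Real.logb ρ X)).le
    have e2 : Real.logb ρ X ≤ 1 / X * (1 / (1 - ρ)) := by
      have f1 : Real.logb ρ X = Real.log (1 / X) / (-Real.log ρ) := by
        rw [one_div, Real.log_inv, neg_div_neg_eq, Real.logb]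
      have f2 : 1 - ρ ≤ -Real.log ρ := by linarith [Real.log_le_sub_one_of_pos hρ0]
      have f3 := Real.log_le_sub_one_of_pos (one_div_pos.2 hX0)
      rw [f1, mul_one_div]
      exact div_le_div₀ (one_div_pos.2 hX0).le (by linarith) hρ f2
    have e3 : 1 / X = (2 + Z) ^ 2 * C * cA / (2 * νmin * (1 - γ) ^ 2) := by
      rw [hX, one_div_div]
    rw [← e3]
    linarith

/-- All the parameters are polynomial in `Λ`. -/
theorem paramH_mul_div_le {C ρ νmin : ℝ} {k : ℕ} (hγ0 : 0 < γ) (hγ1 : γ < 1)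
    (hA : 1 ≤ cA) (hC : 1 ≤ C) (hρ0 : 0 < ρ) (hρ1 : ρ < 1) (hν0 : 0 < νmin) (hν1 : νmin ≤ 1)
    (hk : 1 ≤ k) (hΛ9 : 9 ≤ Λ) (hAΛ : cA ≤ Λ) (hmΛ : 1 / (1 - γ) ≤ Λ) (hρΛ : 1 / (1 - ρ) ≤ Λ)
    (hCΛ : C ≤ Λ) (hνΛ : 1 / νmin ≤ Λ) (hkΛ : (k : ℝ) ≤ Λ ^ 24)
    (hl1 : 1 ≤ Real.log (cS * k / δ)) (hl2 : Real.log (cS * k / δ) ≤ 26 * Real.log Λ) :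
    paramH cS cA k γ δ C ρ νmin * cA / paramEps cS k γ δ ≤ Λ ^ 52 := by
  have hγ := sub_pos.2 hγ1
  have hρ := sub_pos.2 hρ1
  have hA1 : (1:ℝ) ≤ cA := by exact_mod_cast hA
  have hk1 : (1:ℝ) ≤ k := by exact_mod_cast hk
  have hΛ0 : 0 < Λ := by linarith
  obtain ⟨hH, hT0, hT⟩ := paramH_le (cS := cS) (k := k) (δ := δ) hγ0 hγ1 hA hC hρ0 hρ1 hν0 hν1
  have hZ := paramZ_nonneg (cS := cS) (k := k) (δ := δ) hγ1
  set Z := paramZ cS k γ δ with hZdef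
  set T := paramTmix cS cA k γ δ C ρ νmin
  set H := paramH cS cA k γ δ C ρ νmin
  set m := 1 / (1 - γ) with hm
  have hm1 : 1 ≤ m := (one_le_div hγ).2 (by linarith)
  have hm2 : m ^ 2 ≤ Λ ^ 2 := pow_le_pow_left₀ (by linarith) hmΛ 2
  have hstep : ∀ (c : ℝ) (i : ℕ), c ≤ 9 → c * Λ ^ i ≤ Λ ^ (i + 1) := fun c i hc => by
    rw [pow_succ']
    exact mul_le_mul_of_nonneg_right (hc.trans hΛ9) (by positivity)
  have hone : ∀ i : ℕ, 1 ≤ Λ ^ i := fun i => one_le_pow₀ (by linarith)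
  have hZ2 : Z ^ 2 ≤ Λ ^ 6 := by
    have e1 : Z ^ 2 = 16 * (m ^ 2 * Real.log (cS * k / δ)) := by
      rw [hZdef, paramZ, div_pow, mul_pow, Real.sq_sqrt (by linarith), hm]
      field_simp
      norm_num
    have e2 := Real.log_le_sub_one_of_pos hΛ0
    have e3 : m ^ 2 * Real.log (cS * k / δ) ≤ Λ ^ 2 * (26 * Λ) :=
      mul_le_mul hm2 (by linarith) (by linarith) (by positivity)
    have e4 : (416:ℝ) ≤ Λ ^ 3 := by
      have := pow_le_pow_left₀ (by norm_num) hΛ9 3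
      linarith
    have e5 := mul_le_mul_of_nonneg_right e4 (by positivity : 0 ≤ Λ ^ 3)
    rw [e1]
    nlinarith
  have hZ3 : (2 + Z) ^ 2 ≤ Λ ^ 7 := by
    have e1 : (2 + Z) ^ 2 ≤ 8 + 2 * Z ^ 2 := by nlinarith [sq_nonneg (2 - Z)]
    have e2 : 9 * Λ ^ 6 ≤ Λ ^ 7 := hstep 9 6 le_rfl
    have e4 : (8:ℝ) ≤ 7 * Λ ^ 6 := by
      have : Λ ≤ Λ ^ 6 := le_self_pow₀ (by linarith) (by norm_num)
      linarith
    linarith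
  have hT14 : T ≤ Λ ^ 14 := by
    have e1 : (2 + Z) ^ 2 * C * cA / (2 * νmin * (1 - γ) ^ 2) * (1 / (1 - ρ)) =
        (2 + Z) ^ 2 * C * cA * (1 / νmin) * m ^ 2 * (1 / (1 - ρ)) / 2 := by
      rw [hm]
      field_simp
    have e2 : (2 + Z) ^ 2 * C * cA * (1 / νmin) * m ^ 2 * (1 / (1 - ρ)) ≤
        Λ ^ 7 * Λ * Λ * Λ * Λ ^ 2 * Λ := by gcongr
    have e3 : Λ ^ 7 * Λ * Λ * Λ * Λ ^ 2 * Λ = Λ ^ 13 := by ring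
    have e4 : 9 * Λ ^ 13 ≤ Λ ^ 14 := hstep 9 13 le_rfl
    linarith [hone 13]
  have hH27 : H ≤ Λ ^ 27 := by
    have e1 : T * (2 + Z) ^ 2 * cA / (νmin * (1 - γ) ^ 2) =
        T * (2 + Z) ^ 2 * cA * (1 / νmin) * m ^ 2 := by
      rw [hm]
      field_simp
    have e2 : T * (2 + Z) ^ 2 * cA * (1 / νmin) * m ^ 2 ≤ Λ ^ 14 * Λ ^ 7 * Λ * Λ * Λ ^ 2 := by
      gcongr
    have e3 : Λ ^ 14 * Λ ^ 7 * Λ * Λ * Λ ^ 2 = Λ ^ 25 := by ring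
    have e4 : m ≤ Λ ^ 25 := hmΛ.trans (le_self_pow₀ (by linarith) (by norm_num))
    have e5 : 9 * Λ ^ 25 ≤ Λ ^ 26 := hstep 9 25 le_rfl
    have e6 : 9 * Λ ^ 26 ≤ Λ ^ 27 := hstep 9 26 le_rfl
    linarith
  have hε : paramEps cS k γ δ = 2 * m * √(Real.log (cS * k / δ)) / √k := by
    rw [paramEps, Real.sqrt_div (by linarith), hm]
    ring
  have hsk : 0 < √(k:ℝ) := Real.sqrt_pos.2 (by linarith)
  -- This keeps `1 / ε` polynomial in `Λ`, through `k ≤ Λ ^ 24`; it needs the logarithm to be at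
  -- least 1.
  have hε1 : 1 / √k ≤ paramEps cS k γ δ := by
    rw [hε]
    have e1 : 1 ≤ √(Real.log (cS * k / δ)) := Real.one_le_sqrt.2 hl1
    gcongr
    nlinarith
  have hsk1 : √(k:ℝ) ≤ Λ ^ 24 := (Real.sqrt_le_self_iff.2 (Or.inr hk1)).trans hkΛ
  have hε0 : 0 < paramEps cS k γ δ := (by positivity : (0:ℝ) < 1 / √k).trans_le hε1
  rw [div_le_iff₀ hε0]
  calc H * cA ≤ Λ ^ 27 * Λ := by gcongr
    _ ≤ Λ ^ 52 * (1 / √k) := by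
      rw [mul_one_div, le_div_iff₀ hsk]
      calc Λ ^ 27 * Λ * √k ≤ Λ ^ 27 * Λ * Λ ^ 24 := by gcongr
        _ = Λ ^ 52 := by ring
    _ ≤ _ := by gcongr

end SampleComplexity

section SampleComplexity

/-- Choice of the numbers of iterations and of samples per iteration for the accuracy `ϵ`. -/
theorem exists_sample_sizes {cS cA : ℕ} {γ C ρ νmin δ ϵ : ℝ} (hS : 1 ≤ cS) (hA : 1 ≤ cA)
    (hγ0 : 0 < γ) (hγ1 : γ < 1) (hC : 1 ≤ C) (hρ0 : 0 < ρ) (hρ1 : ρ < 1) (hν0 : 0 < νmin)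
    (hν1 : νmin ≤ 1) (hδ0 : 0 < δ) (hδ1 : δ < 1) (hϵ0 : 0 < ϵ) (hϵ1 : ϵ ≤ 1 / (1 - γ)) :
    ∃ k n : ℕ, 1 ≤ k ∧
      16 * (paramH cS cA k γ δ C ρ νmin *
        Real.log (paramH cS cA k γ δ C ρ νmin * cA / paramEps cS k γ δ)) ≤ n ∧
      paramZ cS k γ δ ≤ 3000000 / (1 - γ) * √(logFactor cS cA γ δ C ρ νmin ϵ) ∧
      (k : ℝ) * n ≤ 3000000 * ((1 / (1 - γ) + paramTmix cS cA k γ δ C ρ νmin *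
          (2 + paramZ cS k γ δ) ^ 2 * cA / (νmin * (1 - γ) ^ 2)) *
        (paramZ cS k γ δ ^ 2 / (1 - γ) ^ 2 + (cA : ℝ) ^ (3 / 2 : ℝ) / (1 - γ) ^ 4) *
        (1 / ϵ ^ 2)) * logFactor cS cA γ δ C ρ νmin ϵ ∧
      4 * (1 / (1 - γ)) / (1 - γ) * √((cA : ℝ) ^ (3 / 2 : ℝ) / k) +
        4 * √(Real.log (cS * k / δ)) / ((1 - γ) ^ 2 * √k) ≤ ϵ := by
  have hγ := sub_pos.2 hγ1
  have hρ := sub_pos.2 hρ1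
  have hA1 : (1:ℝ) ≤ cA := by exact_mod_cast hA
  have hS1 : (1:ℝ) ≤ cS := by exact_mod_cast hS
  set m := 1 / (1 - γ) with hm
  have hm1 : 1 ≤ m := (one_le_div hγ).2 (by linarith)
  have hρ' : 1 ≤ 1 / (1 - ρ) := (one_le_div hρ).2 (by linarith)
  have hν' : 1 ≤ 1 / νmin := (one_le_div hν0).2 hν1
  have hδ' : 1 ≤ 1 / δ := (one_le_div hδ0).2 hδ1.le
  have hϵ' : 0 < 1 / ϵ := by positivity
  set Λ : ℝ := 2 + cS + cA + m + 1 / (1 - ρ) + C + 1 / νmin + 1 / δ + 1 / ϵ with hΛ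
  have hlogF : logFactor cS cA γ δ C ρ νmin ϵ = Real.log Λ := rfl
  have hΛ9 : 9 ≤ Λ := by linarith
  have hΛ0 : 0 < Λ := by linarith
  have hSΛ : cS ≤ Λ := by linarith
  have hAΛ : cA ≤ Λ := by linarith
  have hmΛ : m ≤ Λ := by linarith
  have hρΛ : 1 / (1 - ρ) ≤ Λ := by linarith
  have hCΛ : C ≤ Λ := by linarith
  have hνΛ : 1 / νmin ≤ Λ := by linarith
  have hδΛ : 1 / δ ≤ Λ := by linarith
  have hϵΛ : 1 / ϵ ≤ Λ := by linarith
  clear_value Λ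
  clear hΛ
  obtain ⟨k, hk, hk1, hk2, hkΛ⟩ := exists_iterations hS hA hm1 hδ0 hδ1 hϵ0 hϵ1 hΛ9 hSΛ hAΛ hmΛ
    hδΛ hϵΛ
  have hkr : (1:ℝ) ≤ k := by exact_mod_cast hk
  have hk0 : (0:ℝ) < k := by linarith
  set w := Real.log (cS * k / δ) with hw
  have hw0 : 0 < w := log_card_pos hS hk hδ0 hδ1
  have hAr1 : (1:ℝ) ≤ (cA : ℝ) ^ (3 / 2 : ℝ) := Real.one_le_rpow hA1 (by norm_num)
  set a := (cA : ℝ) ^ (3 / 2 : ℝ) with ha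
  have hk64 : (64:ℝ) ≤ k := by
    have e1 : ϵ ^ 2 ≤ m ^ 2 := pow_le_pow_left₀ hϵ0.le hϵ1 2
    have e2 : m ^ 2 ≤ m ^ 4 := pow_le_pow_right₀ hm1 (by norm_num)
    have e3 : m ^ 4 ≤ m ^ 4 * (a + w) := le_mul_of_one_le_right (by positivity) (by linarith)
    have e4 : 64 * ϵ ^ 2 ≤ k * ϵ ^ 2 := by linarith
    exact le_of_mul_le_mul_right e4 (by positivity)
  have hw1 : 1 ≤ w := by
    have e1 : (64:ℝ) ≤ cS * k / δ := by
      rw [le_div_iff₀ hδ0]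
      have e2 : (k:ℝ) ≤ cS * k := le_mul_of_one_le_left hk0.le hS1
      linarith
    linarith [four_le_log_of_le e1]
  have hw26 : w ≤ 26 * Real.log Λ := by
    have e1 : cS * k / δ ≤ Λ ^ 26 := by
      have e2 : cS * k / δ = cS * k * (1 / δ) := by ring
      have e3 : cS * k * (1 / δ) ≤ Λ * Λ ^ 24 * Λ := by gcongr
      rw [e2]
      refine e3.trans (le_of_eq (by ring))
    have e2 := Real.log_le_log (by positivity) e1
    rw [Real.log_pow] at e2
    rw [hw]
    refine e2.trans (le_of_eq ?_)
    norm_num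
  have hlogΛ : 0 < Real.log Λ := Real.log_pos (by linarith)
  obtain ⟨hH, hT0, -⟩ := paramH_le (cS := cS) (k := k) (δ := δ) hγ0 hγ1 hA hC hρ0 hρ1 hν0 hν1
  have hpoly := paramH_mul_div_le (Λ := Λ) (cS := cS) (k := k) (δ := δ) hγ0 hγ1 hA hC hρ0 hρ1
    hν0 hν1 hk hΛ9 hAΛ hmΛ hρΛ hCΛ hνΛ hkΛ hw1 hw26
  have h64 := le_paramH_div (C := C) (ρ := ρ) (νmin := νmin) hγ0 hγ1 hS hA hk hδ0 hδ1 hC hρ0 hρ1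
    hν0 hν1
  have hlog4 := four_le_log_of_le h64
  have hlog52 := Real.log_le_log (by linarith) hpoly
  rw [Real.log_pow] at hlog52
  push_cast at hlog52
  have hHm : m ≤ paramH cS cA k γ δ C ρ νmin := by
    obtain ⟨hx0, hx1⟩ := logb_arg_bounds (cS := cS) (k := k) (δ := δ) hγ0 hγ1 hA hC hν0 hν1
    have hc : (0:ℝ) ≤ ⌈Real.logb ρ (νmin * paramTau cS cA k γ δ / (2 * C))⌉ := by
      exact_mod_cast (Int.ceil_pos.2 (Real.logb_pos_of_base_lt_one hρ0 hρ1 hx0 hx1)).le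
    exact le_add_of_nonneg_right (div_nonneg hc (mul_pos hν0 (paramTau_pos hγ1 hA)).le)
  have hZ0 := paramZ_nonneg (cS := cS) (k := k) (δ := δ) hγ1
  have hZsq : paramZ cS k γ δ ^ 2 = 16 * m ^ 2 * w := by
    rw [paramZ, div_pow, mul_pow, Real.sq_sqrt hw0.le, hm]
    field_simp
    norm_num
  set W := m + paramTmix cS cA k γ δ C ρ νmin *
    (2 + paramZ cS k γ δ) ^ 2 * cA / (νmin * (1 - γ) ^ 2) with hW
  have hW0 : 0 < W := by positivity
  set H := paramH cS cA k γ δ C ρ νmin with hHdef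
  set L := Real.log (H * cA / paramEps cS k γ δ) with hL
  refine ⟨k, ⌈16 * (H * L)⌉₊, hk, Nat.le_ceil _, ?_, ?_, ?_⟩
  · rw [hlogF]
    refine le_of_sq_le_sq ?_ (by positivity)
    rw [hZsq, mul_pow, Real.sq_sqrt hlogΛ.le]
    have e1 : (3000000 / (1 - γ)) ^ 2 = 3000000 ^ 2 * m ^ 2 := by
      rw [hm]
      ring
    rw [e1]
    have e2 := mul_le_mul_of_nonneg_left hw26 (by positivity : 0 ≤ 16 * m ^ 2)
    have e3 : 0 ≤ m ^ 2 * Real.log Λ := by positivity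
    linarith
  · have hHL : 1 ≤ H * L := one_le_mul_of_one_le_of_one_le (hm1.trans hHm) (by linarith)
    have hn : (⌈16 * (H * L)⌉₊ : ℝ) ≤ 17 * (20 * W * (52 * Real.log Λ)) := by
      have e1 := (Nat.ceil_lt_add_one (by linarith : 0 ≤ 16 * (H * L))).le
      have e2 : H * L ≤ 20 * W * (52 * Real.log Λ) :=
        mul_le_mul hH hlog52 (by linarith) (by positivity)
      linarith
    have hkk : (k:ℝ) ≤ 128 * (m ^ 4 * (a + w)) * (1 / ϵ ^ 2) := by
      rw [mul_one_div, le_div_iff₀ (by positivity)]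
      linarith
    have hY : m ^ 4 * (a + w) ≤ paramZ cS k γ δ ^ 2 / (1 - γ) ^ 2 + a / (1 - γ) ^ 4 := by
      have e1 : paramZ cS k γ δ ^ 2 / (1 - γ) ^ 2 + a / (1 - γ) ^ 4 =
          16 * (m ^ 4 * w) + m ^ 4 * a := by
        rw [hZsq, hm]
        field_simp
      have e2 : 0 ≤ m ^ 4 * w := by positivity
      rw [e1]
      linarith
    set Y := paramZ cS k γ δ ^ 2 / (1 - γ) ^ 2 + a / (1 - γ) ^ 4 with hYdef
    have hY0 : 0 ≤ Y := by positivity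
    have hkk2 : (k:ℝ) ≤ 128 * Y * (1 / ϵ ^ 2) := hkk.trans (by gcongr)
    rw [hlogF]
    -- The product of the constants is `128 * 17 * 20 * 52 = 2263040`, below 3000000.
    have e3 := mul_le_mul hkk2 hn (by positivity) (by positivity)
    have e4 : 0 ≤ W * Y * (1 / ϵ ^ 2) * Real.log Λ := by positivity
    refine e3.trans ?_
    linarith
  · have e1 := optimality_bound_le hk0 (by linarith : 0 ≤ a) hw0.le (by linarith : 0 < m) hϵ0 hk1
    refine le_trans (le_of_eq ?_) e1
    rw [← hw, hm]
    clear_value w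
    field_simp

end SampleComplexity

end TsallisSPMD

end

theorem mainTheorem3 :
    ∃ c₁ c₂ : ℝ, 0 < c₁ ∧ 0 < c₂ ∧
      ∀ (S A : Type*) [Fintype S] [DecidableEq S] [Nonempty S] [Fintype A] [Nonempty A]
        (γ C ρ νmin δ : ℝ), 0 < γ → γ < 1 → 1 ≤ C → 0 < ρ → ρ < 1 → 0 < νmin → νmin ≤ 1 →
        0 < δ → δ < 1 →
        -- high-probability bound for every number of iterations and long enough trajectories
        (∀ k n : ℕ, 1 ≤ k →
          c₁ * (TsallisSPMD.paramH (Fintype.card S) (Fintype.card A) k γ δ C ρ νmin *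
            Real.log (TsallisSPMD.paramH (Fintype.card S) (Fintype.card A) k γ δ C ρ νmin *
              Fintype.card A / TsallisSPMD.paramEps (Fintype.card S) k γ δ)) ≤ n →
          ∀ M : TsallisSPMD.MDP S A, M.γ = γ →
          ∀ start : TsallisSPMD.StartRule S A n, start.IsValid →
          TsallisSPMD.RunMixes M (TsallisSPMD.paramEta (Fintype.card A) k γ)
            (TsallisSPMD.paramTau (Fintype.card S) (Fintype.card A) k γ δ) k start C ρ νmin →
          ∀ πs : S → A → ℝ, TsallisSPMD.IsOptimalPolicy M πs →
            1 - δ ≤ TsallisSPMD.runProb M (TsallisSPMD.paramEta (Fintype.card A) k γ)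
              (TsallisSPMD.paramTau (Fintype.card S) (Fintype.card A) k γ δ) start
              {ξ : Fin k → Fin n → S × A | ∀ ϑ ∈ stdSimplex ℝ S,
                TsallisSPMD.bestGap M (TsallisSPMD.paramEta (Fintype.card A) k γ)
                  (TsallisSPMD.paramTau (Fintype.card S) (Fintype.card A) k γ δ) ϑ πs ξ ≤
                4 * (1 / (1 - γ)) / (1 - γ) * √((Fintype.card A : ℝ) ^ (3 / 2 : ℝ) / k) +
                  4 * √(Real.log (Fintype.card S * k / δ)) / ((1 - γ) ^ 2 * √k)}) ∧
        -- sample complexity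
        (∀ ϵ : ℝ, 0 < ϵ → ϵ ≤ 1 / (1 - γ) → ∃ k n : ℕ, 1 ≤ k ∧
          c₁ * (TsallisSPMD.paramH (Fintype.card S) (Fintype.card A) k γ δ C ρ νmin *
            Real.log (TsallisSPMD.paramH (Fintype.card S) (Fintype.card A) k γ δ C ρ νmin *
              Fintype.card A / TsallisSPMD.paramEps (Fintype.card S) k γ δ)) ≤ n ∧
          TsallisSPMD.paramZ (Fintype.card S) k γ δ ≤
            c₂ / (1 - γ) *
              √(TsallisSPMD.logFactor (Fintype.card S) (Fintype.card A) γ δ C ρ νmin ϵ) ∧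
          (k : ℝ) * n ≤
            c₂ * ((1 / (1 - γ) +
                TsallisSPMD.paramTmix (Fintype.card S) (Fintype.card A) k γ δ C ρ νmin *
                  (2 + TsallisSPMD.paramZ (Fintype.card S) k γ δ) ^ 2 * Fintype.card A /
                  (νmin * (1 - γ) ^ 2)) *
              (TsallisSPMD.paramZ (Fintype.card S) k γ δ ^ 2 / (1 - γ) ^ 2 +
                (Fintype.card A : ℝ) ^ (3 / 2 : ℝ) / (1 - γ) ^ 4) *
              (1 / ϵ ^ 2)) *
              TsallisSPMD.logFactor (Fintype.card S) (Fintype.card A) γ δ C ρ νmin ϵ ∧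
          ∀ M : TsallisSPMD.MDP S A, M.γ = γ →
          ∀ start : TsallisSPMD.StartRule S A n, start.IsValid →
          TsallisSPMD.RunMixes M (TsallisSPMD.paramEta (Fintype.card A) k γ)
            (TsallisSPMD.paramTau (Fintype.card S) (Fintype.card A) k γ δ) k start C ρ νmin →
          ∀ πs : S → A → ℝ, TsallisSPMD.IsOptimalPolicy M πs →
            1 - δ ≤ TsallisSPMD.runProb M (TsallisSPMD.paramEta (Fintype.card A) k γ)
              (TsallisSPMD.paramTau (Fintype.card S) (Fintype.card A) k γ δ) start
              {ξ : Fin k → Fin n → S × A | ∀ ϑ ∈ stdSimplex ℝ S,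
                TsallisSPMD.bestGap M (TsallisSPMD.paramEta (Fintype.card A) k γ)
                  (TsallisSPMD.paramTau (Fintype.card S) (Fintype.card A) k γ δ) ϑ πs ξ ≤ ϵ}) := by
  refine ⟨16, 3000000, by norm_num, by norm_num, ?_⟩
  intro S A _ _ _ _ _ γ C ρ νmin δ hγ0 hγ1 hC hρ0 hρ1 hν0 hν1 hδ0 hδ1
  refine ⟨fun k n hk hn M hM start hs hmix πs hopt =>
    TsallisSPMD.le_runProb_bestGap hγ0 hγ1 hC hρ0 hρ1 hν0 hν1 hδ0 hδ1 hk hn M hM hs hmix hopt,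
    fun ϵ hϵ0 hϵ1 => ?_⟩
  obtain ⟨k, n, hk, hn, hZ, hkn, hbound⟩ := TsallisSPMD.exists_sample_sizes
    (Fintype.card_pos (α := S)) (Fintype.card_pos (α := A)) hγ0 hγ1 hC hρ0 hρ1 hν0 hν1 hδ0 hδ1
    hϵ0 hϵ1
  refine ⟨k, n, hk, hn, hZ, hkn, fun M hM start hs hmix πs hopt => ?_⟩
  exact (TsallisSPMD.le_runProb_bestGap hγ0 hγ1 hC hρ0 hρ1 hν0 hν1 hδ0 hδ1 hk hn M hM hs hmix
    hopt).trans
    (TsallisSPMD.runProb_mono M (Real.sqrt_nonneg _) _ hs fun ξ hξ _ ϑ hϑ =>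
      (hξ ϑ hϑ).trans hbound)
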